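/- A bipartite graph $G=(A,B,E)$ is given with its bipartition. Three operations are considered: adding an edge between a vertex of $A$ and a vertex of $B$; deleting an edge; and splitting a vertex $v$, that is, replacing $v$ by two copies $v_1,v_2$ on the same side with $N(v_1)\cup N(v_2)=N(v)$ (the two neighborhoods may overlap). In Bicluster Editing with Vertex Splitting (BCEVS), one is given $G$ and a number $k$ and asks whether at most $k$ operations can turn $G$ into a disjoint union of bicliques, i.e. a bipartite graph in which any two vertices of the same connected component on different sides are adjacent. Bicluster Editing with One-Sided Vertex Splitting (BCEOVS) is the same problem where only vertices of the side $B$ may be split. **Theorem.** Restricted to trees, BCEVS and BCEOVS are solvable in time $O(n^2)$, where $n$ is the number of vertices. That is, for each of the two problems there are a random access machine program and a constant $C$ such that, for every tree $T=(A,B,E)$ on the vertices $0,\dots,n-1$ (given by the side of each vertex and a list of the edges in arbitrary order and orientation) and every $k\ge 0$, the program halts after at most $Cn^2$ steps with the correct answer to the instance $(T,k)$. Likewise, for each of the two problems there is a program that computes from $T$, in at most $Cn^2$ steps for a constant $C$, the minimum number of operations needed. Here each instruction (setting a register to a constant, copying a register, successor, predecessor, indirect load, indirect store) and each comparison of two registers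 counts as one step. -/

import Mathlib

/-- The two sides of a bipartite graph. -/
inductive Side where
  | A
  | B

/-- A bipartite graph `G = (A, B, E)` on the vertex type `V`: a simple graph together with the
side of each vertex, every edge joining the two sides. -/
structure BipGraph (V : Type) where
  graph : SimpleGraph V
  side : V → Side
  side_ne : ∀ u v, graph.Adj u v → side u ≠ side v

namespace BipGraph

/-- `H` arises from `G` by adding one new edge between a vertex of `A` and a vertex of `B`. -/
def IsEdgeAddition {V : Type} (G H : BipGraph V) : Prop :=
  H.side = G.side ∧ ∃ a b, ¬ G.graph.Adj a b ∧ G.side a ≠ G.side b ∧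
    ∀ u v, H.graph.Adj u v ↔ (G.graph.Adj u v ∨ s(u, v) = s(a, b))

/-- `H` arises from `G` by deleting one edge. -/
def IsEdgeDeletion {V : Type} (G H : BipGraph V) : Prop :=
  H.side = G.side ∧ ∃ a b, G.graph.Adj a b ∧
    ∀ u v, H.graph.Adj u v ↔ (G.graph.Adj u v ∧ s(u, v) ≠ s(a, b))

/-- `H` arises from `G` by splitting the vertex `v` into the two copies `some v` and `none`, which
lie on the side of `v` and whose neighborhoods have union `N(v)` (they may overlap, and either may
be empty). Every other vertex `u` is kept as `some u`. The copies are not adjacent to each other,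
because they lie on the same side. -/
def IsSplitAt {V : Type} (G : BipGraph V) (v : V) (H : BipGraph (Option V)) : Prop :=
  (∀ u, H.side (some u) = G.side u) ∧ H.side none = G.side v ∧
  (∀ u w, u ≠ v → w ≠ v → (H.graph.Adj (some u) (some w) ↔ G.graph.Adj u w)) ∧
  (∀ w, w ≠ v →
    (G.graph.Adj v w ↔ (H.graph.Adj (some v) (some w) ∨ H.graph.Adj none (some w))))

/-- `EditSeq S G H m`: the graph `H` arises from `G` by a sequence of exactly `m` edge additions,
edge deletions and vertex splittings, where only vertices on a side in `S` are split. -/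
inductive EditSeq (S : Set Side) :
    {V W : Type} → BipGraph V → BipGraph W → ℕ → Prop where
  | nil {V : Type} (G : BipGraph V) : EditSeq S G G 0
  | add {V W : Type} {G G' : BipGraph V} {H : BipGraph W} {m : ℕ} :
      IsEdgeAddition G G' → EditSeq S G' H m → EditSeq S G H (m + 1)
  | del {V W : Type} {G G' : BipGraph V} {H : BipGraph W} {m : ℕ} :
      IsEdgeDeletion G G' → EditSeq S G' H m → EditSeq S G H (m + 1)
  | split {V W : Type} {G : BipGraph V} {G' : BipGraph (Option V)} {H : BipGraph W} {m : ℕ}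
      (v : V) : G.side v ∈ S → IsSplitAt G v G' → EditSeq S G' H m → EditSeq S G H (m + 1)

/-- `G` is a disjoint union of bicliques: in every connected component all pairs of vertices
from different sides are adjacent. (An isolated vertex is a biclique with one empty side.) -/
def IsBiclusterGraph {V : Type} (G : BipGraph V) : Prop :=
  ∀ u v, G.graph.Reachable u v → G.side u ≠ G.side v → G.graph.Adj u v

/-- `m` operations, with splittings only on the sides in `S`, can turn `G` into a disjoint union
of bicliques. -/
def CanBecomeBicluster (S : Set Side) {V : Type} (G : BipGraph V) (m : ℕ) : Prop :=
  ∃ (W : Type) (H : BipGraph W), EditSeq S G H m ∧ H.IsBiclusterGraph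

end BipGraph

/-- Bicluster Editing with Vertex Splitting: `(G, k)` is a yes-instance. -/
def BCEVS {V : Type} (G : BipGraph V) (k : ℕ) : Prop :=
  ∃ m ≤ k, G.CanBecomeBicluster Set.univ m

/-- Bicluster Editing with One-Sided Vertex Splitting: `(G, k)` is a yes-instance; only vertices
of the side `B` may be split. -/
def BCEOVS {V : Type} (G : BipGraph V) (k : ℕ) : Prop :=
  ∃ m ≤ k, G.CanBecomeBicluster {Side.B} m

namespace RAM

/-- Memory of a random access machine: registers and arrays, all holding natural numbers.
A program mentions only finitely many registers and arrays. -/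
structure State where
  reg : ℕ → ℕ
  arr : ℕ → ℕ → ℕ

def State.setReg (s : State) (r x : ℕ) : State :=
  { s with reg := Function.update s.reg r x }

def State.setArr (s : State) (a i x : ℕ) : State :=
  { s with arr := Function.update s.arr a (Function.update (s.arr a) i x) }

/-- Unit-cost instructions. The only arithmetic is successor and predecessor, so a run of `t` steps
uses only numbers bounded by the input numbers, the constants of the program and `t`:
no large numbers can be manipulated at unit cost. -/
inductive Instr where
  /-- `reg r := c` -/
  | const (r c : ℕ)
  /-- `reg r := reg q` -/
  | move (r q : ℕ)
  /-- `reg r := reg r + 1` -/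
  | succ (r : ℕ)
  /-- `reg r := reg r - 1`, with `0 - 1 = 0` -/
  | pred (r : ℕ)
  /-- `reg r := arr a [reg i]` -/
  | load (r a i : ℕ)
  /-- `arr a [reg i] := reg r` -/
  | store (a i r : ℕ)

def Instr.apply : Instr → State → State
  | .const r c, s => s.setReg r c
  | .move r q, s => s.setReg r (s.reg q)
  | .succ r, s => s.setReg r (s.reg r + 1)
  | .pred r, s => s.setReg r (s.reg r - 1)
  | .load r a i, s => s.setReg r (s.arr a (s.reg i))
  | .store a i r, s => s.setArr a (s.reg i) (s.reg r)

/-- Tests comparing two registers. -/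
inductive Test where
  | eq (r q : ℕ)
  | lt (r q : ℕ)

def Test.Holds : Test → State → Prop
  | .eq r q, s => s.reg r = s.reg q
  | .lt r q, s => s.reg r < s.reg q

/-- Programs. -/
inductive Prog where
  | instr (c : Instr)
  | seq (P Q : Prog)
  | ite (b : Test) (P Q : Prog)
  | loop (b : Test) (P : Prog)

/-- `Exec P s t s'`: started in `s`, the program `P` halts in the state `s'` after exactly `t` steps.
Each instruction and each evaluation of a test is one step; `loop b P` is "while `b` do `P`". -/
inductive Exec : Prog → State → ℕ → State → Prop where
  | instr (c : Instr) (s : State) : Exec (.instr c) s 1 (c.apply s)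
  | seq {P Q : Prog} {s s' s'' : State} {t t' : ℕ} :
      Exec P s t s' → Exec Q s' t' s'' → Exec (.seq P Q) s (t + t') s''
  | ite_true {b : Test} {P Q : Prog} {s s' : State} {t : ℕ} :
      b.Holds s → Exec P s t s' → Exec (.ite b P Q) s (t + 1) s'
  | ite_false {b : Test} {P Q : Prog} {s s' : State} {t : ℕ} :
      ¬ b.Holds s → Exec Q s t s' → Exec (.ite b P Q) s (t + 1) s'
  | loop_true {b : Test} {P : Prog} {s s' s'' : State} {t t' : ℕ} :
      b.Holds s → Exec P s t s' → Exec (.loop b P) s' t' s'' →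
      Exec (.loop b P) s (t + t' + 1) s''
  | loop_false {b : Test} {P : Prog} {s : State} :
      ¬ b.Holds s → Exec (.loop b P) s 1 s

end RAM

/-- `L` lists every edge of `G` exactly once, in any order and each with any orientation. -/
def IsEdgeList {n : ℕ} (G : SimpleGraph (Fin n)) (L : List (Fin n × Fin n)) : Prop :=
  (L.map fun p => s(p.1, p.2)).Nodup ∧ ∀ u v, G.Adj u v ↔ s(u, v) ∈ L.map fun p => s(p.1, p.2)

def Side.code : Side → ℕ
  | .A => 0
  | .B => 1

/-- Encoding of a bipartite graph on the vertices `0, …, n - 1` with edge list `L`, together with a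
number `k`. Registers `0, 1, 2` hold the number of vertices, the number of edges and `k`. Array `0`
holds the sides of the vertices, arrays `1` and `2` the first and second endpoints of the listed
edges. Everything else is `0`. -/
def inputState {n : ℕ} (G : BipGraph (Fin n)) (L : List (Fin n × Fin n)) (k : ℕ) : RAM.State where
  reg r := if r = 0 then n else if r = 1 then L.length else if r = 2 then k else 0
  arr a i :=
    if a = 0 then (if h : i < n then (G.side ⟨i, h⟩).code else 0)
    else if a = 1 then (if h : i < L.length then (L[i].1 : ℕ) else 0)
    else if a = 2 then (if h : i < L.length then (L[i].2 : ℕ) else 0)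
    else 0

/-- `P` decides the problem `Q` on trees within `time n` steps, `n` being the number of vertices:
it leaves the answer (`1` for yes, `0` for no) in register `0`. -/
def DecidesOnTrees (P : RAM.Prog) (Q : ∀ {n : ℕ}, BipGraph (Fin n) → ℕ → Prop)
    (time : ℕ → ℕ) : Prop :=
  ∀ (n : ℕ) (T : BipGraph (Fin n)) (L : List (Fin n × Fin n)) (k : ℕ),
    T.graph.IsTree → IsEdgeList T.graph L →
      ∃ (t : ℕ) (s : RAM.State), RAM.Exec P (inputState T L k) t s ∧ t ≤ time n ∧
        (Q T k → s.reg 0 = 1) ∧ (¬ Q T k → s.reg 0 = 0)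

/-- `P` computes on trees, within `time n` steps and in register `0`, the minimum `k` for which
`(T, k)` is a yes-instance of `Q`. (The input has no `k`; its register is initially `0`.) -/
def ComputesMinOnTrees (P : RAM.Prog) (Q : ∀ {n : ℕ}, BipGraph (Fin n) → ℕ → Prop)
    (time : ℕ → ℕ) : Prop :=
  ∀ (n : ℕ) (T : BipGraph (Fin n)) (L : List (Fin n × Fin n)),
    T.graph.IsTree → IsEdgeList T.graph L →
      ∃ (t : ℕ) (s : RAM.State), RAM.Exec P (inputState T L 0) t s ∧ t ≤ time n ∧
        IsLeast {k | Q T k} (s.reg 0)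

namespace BipGraph

/-- The edges of `G` from side `A` to side `B`, as ordered pairs, that no edge of `H` lies over. -/
def uncovered {V W : Type} (G : BipGraph V) (H : BipGraph W) (φ : W → V) : Set (V × V) :=
  {q | (G.side q.1 = Side.A ∧ G.side q.2 = Side.B) ∧ G.graph.Adj q.1 q.2 ∧
    ∀ a b, φ a = q.1 → φ b = q.2 → ¬ H.graph.Adj a b}

/-- The non-adjacent pairs of `G` from side `A` to side `B` that some edge of `H` lies over. -/
def surplus {V W : Type} (G : BipGraph V) (H : BipGraph W) (φ : W → V) : Set (V × V) :=
  {q | (G.side q.1 = Side.A ∧ G.side q.2 = Side.B) ∧ ¬ G.graph.Adj q.1 q.2 ∧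
    ∃ a b, φ a = q.1 ∧ φ b = q.2 ∧ H.graph.Adj a b}

theorem exists_oriented {V : Type} (G : BipGraph V) {a b : V} (h : G.side a ≠ G.side b) :
    ∃ c d, G.side c = Side.A ∧ G.side d = Side.B ∧ s(c, d) = s(a, b) := by
  rcases ha : G.side a with _ | _ <;> rcases hb : G.side b with _ | _
  · exact absurd (ha.trans hb.symm) h
  · exact ⟨a, b, ha, hb, rfl⟩
  · exact ⟨b, a, hb, ha, Sym2.eq_swap⟩
  · exact absurd (ha.trans hb.symm) h

theorem eq_of_oriented {V : Type} (G : BipGraph V) {a b c d : V} (ha : G.side a = Side.A)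
    (hd : G.side d = Side.B)
    (h : s(a, b) = s(c, d)) : (a, b) = (c, d) := by
  rcases Sym2.eq_iff.1 h with ⟨rfl, rfl⟩ | ⟨rfl, rfl⟩
  · rfl
  · rw [ha] at hd; cases hd

/-- The map that identifies the two copies of a split vertex `v`. -/
def collapse {V : Type} (v : V) : Option V → V := fun x => x.getD v

theorem IsSplitAt.adj_collapse {V : Type} {G : BipGraph V} {v : V} {H : BipGraph (Option V)}
    (h : IsSplitAt G v H) {x y : Option V} (hxy : H.graph.Adj x y) :
    G.graph.Adj (collapse v x) (collapse v y) := by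
  obtain ⟨h1, h2, h3, h4⟩ := h
  have hs := H.side_ne _ _ hxy
  have key : ∀ x : Option V, collapse v x = v ∨ ∃ u, u ≠ v ∧ x = some u := by
    intro x
    cases x with
    | none => exact Or.inl rfl
    | some u =>
      by_cases hu : u = v
      · exact Or.inl hu
      · exact Or.inr ⟨u, hu, rfl⟩
  have side : ∀ x : Option V, H.side x = G.side (collapse v x) := by
    intro x
    cases x with
    | none => exact h2
    | some u => exact h1 u
  have copies : ∀ x : Option V, collapse v x = v → x = none ∨ x = some v := by
    intro x hx
    cases x with
    | none => exact Or.inl rfl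
    | some u => exact Or.inr (congrArg some hx)
  have one : ∀ (x : Option V) (w : V), collapse v x = v → w ≠ v → H.graph.Adj x (some w) →
      G.graph.Adj v w := by
    intro x w hx hw hadj
    rcases copies x hx with rfl | rfl
    · exact (h4 w hw).2 (Or.inr hadj)
    · exact (h4 w hw).2 (Or.inl hadj)
  rcases key x with hx | ⟨u, hu, rfl⟩ <;> rcases key y with hy | ⟨w, hw, rfl⟩
  · exact absurd (by rw [side, side, hx, hy]) hs
  · rw [hx]; exact one x w hx hw hxy
  · rw [hy]; exact (one y u hy hu hxy.symm).symm
  · exact (h3 u w hu hw).1 hxy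

theorem IsSplitAt.side_eq {V : Type} {G : BipGraph V} {v : V} {H : BipGraph (Option V)}
    (h : IsSplitAt G v H) (x : Option V) : H.side x = G.side (collapse v x) := by
  cases x with
  | none => exact h.2.1
  | some u => exact h.1 u

theorem IsSplitAt.exists_adj {V : Type} {G : BipGraph V} {v : V} {H : BipGraph (Option V)}
    (h : IsSplitAt G v H) {u w : V} (huw : G.graph.Adj u w) :
    ∃ x y, collapse v x = u ∧ collapse v y = w ∧ H.graph.Adj x y := by
  obtain ⟨h1, h2, h3, h4⟩ := h
  have one : ∀ w, w ≠ v → G.graph.Adj v w → ∃ x, collapse v x = v ∧ H.graph.Adj x (some w) := by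
    intro w hw ha
    rcases (h4 w hw).1 ha with ha | ha
    · exact ⟨some v, rfl, ha⟩
    · exact ⟨none, rfl, ha⟩
  by_cases hu : u = v
  · subst hu
    obtain ⟨x, hx, hadj⟩ := one w huw.ne' huw
    exact ⟨x, some w, hx, rfl, hadj⟩
  · by_cases hw : w = v
    · subst hw
      obtain ⟨x, hx, hadj⟩ := one u hu huw.symm
      exact ⟨some u, x, rfl, hx, hadj.symm⟩
    · exact ⟨some u, some w, rfl, rfl, (h3 u w hu hw).2 huw⟩

/-- The result of `m` operations lies over the original graph, and the new vertices, the deleted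
edges and the added edges together number at most `m`. -/
theorem EditSeq.exists_projection {S : Set Side} {V W : Type} {G : BipGraph V} {H : BipGraph W}
    {m : ℕ} (h : EditSeq S G H m) (hV : Finite V) :
    Finite W ∧ ∃ φ : W → V, Function.Surjective φ ∧ (∀ w, H.side w = G.side (φ w)) ∧
      Nat.card W + (uncovered G H φ).ncard + (surplus G H φ).ncard ≤ Nat.card V + m := by
  induction h with
  | @nil V G =>
    refine ⟨hV, id, Function.surjective_id, fun _ => rfl, ?_⟩
    have h1 : uncovered G G id = ∅ := by
      ext q; simp only [uncovered, Set.mem_ofPred_eq, Set.mem_empty_iff_false, iff_false]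
      exact fun h => h.2.2 _ _ rfl rfl h.2.1
    have h2 : surplus G G id = ∅ := by
      ext q; simp only [surplus, Set.mem_ofPred_eq, Set.mem_empty_iff_false, iff_false]
      rintro ⟨-, h, a, b, rfl, rfl, hab⟩
      exact h hab
    simp [h1, h2]
  | @add V W G G' H m hadd _ ih =>
    obtain ⟨hW, φ, hφ, hside, hle⟩ := ih hV
    obtain ⟨hs, a, b, hab, hne, hadj⟩ := hadd
    obtain ⟨c, d, hc, hd, hcd⟩ := exists_oriented G hne
    refine ⟨hW, φ, hφ, fun w => by rw [hside, hs], ?_⟩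
    have h1 : uncovered G H φ ⊆ uncovered G' H φ := by
      rintro q ⟨hq, hq2, hq3⟩
      exact ⟨by rwa [hs], (hadj _ _).2 (Or.inl hq2), hq3⟩
    have h2 : surplus G H φ ⊆ insert (c, d) (surplus G' H φ) := by
      rintro ⟨x, y⟩ ⟨hq, hq2, hq3⟩
      by_cases hxy : s(x, y) = s(a, b)
      · exact Or.inl (eq_of_oriented G hq.1 hd (hxy.trans hcd.symm))
      · refine Or.inr ⟨by rwa [hs], fun h => ?_, hq3⟩
        rcases (hadj _ _).1 h with h | h
        · exact hq2 h
        · exact hxy h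
    have h3 := Set.ncard_le_ncard h1 (Set.toFinite _)
    have h4 := (Set.ncard_le_ncard h2 (Set.toFinite _)).trans (Set.ncard_insert_le _ _)
    omega
  | @del V W G G' H m hdel _ ih =>
    obtain ⟨hW, φ, hφ, hside, hle⟩ := ih hV
    obtain ⟨hs, a, b, hab, hadj⟩ := hdel
    obtain ⟨c, d, hc, hd, hcd⟩ := exists_oriented G (G.side_ne _ _ hab)
    refine ⟨hW, φ, hφ, fun w => by rw [hside, hs], ?_⟩
    have h1 : surplus G H φ ⊆ surplus G' H φ := by
      rintro q ⟨hq, hq2, hq3⟩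
      exact ⟨by rwa [hs], fun h => hq2 ((hadj _ _).1 h).1, hq3⟩
    have h2 : uncovered G H φ ⊆ insert (c, d) (uncovered G' H φ) := by
      rintro ⟨x, y⟩ ⟨hq, hq2, hq3⟩
      by_cases hxy : s(x, y) = s(a, b)
      · exact Or.inl (eq_of_oriented G hq.1 hd (hxy.trans hcd.symm))
      · exact Or.inr ⟨by rwa [hs], (hadj _ _).2 ⟨hq2, hxy⟩, hq3⟩
    have h3 := Set.ncard_le_ncard h1 (Set.toFinite _)
    have h4 := (Set.ncard_le_ncard h2 (Set.toFinite _)).trans (Set.ncard_insert_le _ _)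
    omega
  | @split V W G G' H m v _ hsplit _ ih =>
    obtain ⟨hW, φ, hφ, hside, hle⟩ := ih inferInstance
    refine ⟨hW, collapse v ∘ φ, Function.Surjective.comp (fun x => ⟨some x, rfl⟩) hφ,
      fun w => by rw [hside, hsplit.side_eq]; rfl, ?_⟩
    have h1 : uncovered G H (collapse v ∘ φ) ⊆
        Prod.map (collapse v) (collapse v) '' uncovered G' H φ := by
      rintro ⟨x, y⟩ ⟨hq, hq2, hq3⟩
      obtain ⟨x', y', rfl, rfl, hxy⟩ := hsplit.exists_adj hq2
      refine ⟨(x', y'), ⟨by rwa [hsplit.side_eq, hsplit.side_eq], hxy, ?_⟩, rfl⟩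
      rintro a b rfl rfl
      exact hq3 a b rfl rfl
    have h2 : surplus G H (collapse v ∘ φ) ⊆
        Prod.map (collapse v) (collapse v) '' surplus G' H φ := by
      rintro ⟨x, y⟩ ⟨hq, hq2, a, b, rfl, rfl, hab⟩
      exact ⟨(φ a, φ b), ⟨by rwa [hsplit.side_eq, hsplit.side_eq],
        fun h => hq2 (hsplit.adj_collapse h), a, b, rfl, rfl, hab⟩, rfl⟩
    have h3 := (Set.ncard_le_ncard h1 (Set.toFinite _)).trans (Set.ncard_image_le (Set.toFinite _))
    have h4 := (Set.ncard_le_ncard h2 (Set.toFinite _)).trans (Set.ncard_image_le (Set.toFinite _))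
    rw [Finite.card_option] at hle
    omega

/-- A spanning subgraph is reached by deleting edges. -/
theorem EditSeq.of_le {S : Set Side} {V : Type} [Finite V] {G H : BipGraph V}
    (hside : H.side = G.side) (hle : H.graph ≤ G.graph) :
    EditSeq S G H (G.graph.edgeSet \ H.graph.edgeSet).ncard := by
  induction hd : (G.graph.edgeSet \ H.graph.edgeSet).ncard generalizing G with
  | zero =>
    have hsub : G.graph.edgeSet ⊆ H.graph.edgeSet := by
      rwa [Set.ncard_eq_zero (Set.toFinite _), Set.sdiff_eq_empty] at hd
    have : G = H := by
      obtain ⟨g, sg, _⟩ := G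
      obtain ⟨h, sh, _⟩ := H
      obtain rfl : g = h := le_antisymm (SimpleGraph.edgeSet_subset_edgeSet.1 hsub) hle
      obtain rfl : sh = sg := hside
      rfl
    subst this
    exact .nil G
  | succ d ih =>
    have hne : (G.graph.edgeSet \ H.graph.edgeSet).Nonempty := by
      rw [← Set.ncard_pos (Set.toFinite _)]; omega
    obtain ⟨e, heG, heH⟩ := hne
    induction e using Sym2.ind with
    | _ a b =>
      let G' : BipGraph V :=
        { graph := G.graph.deleteEdges {s(a, b)}
          side := G.side
          side_ne := fun u v h => G.side_ne u v (G.graph.deleteEdges_le _ h) }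
      have hdel : IsEdgeDeletion G G' := ⟨rfl, a, b, heG, fun u v => by
        simp only [G', SimpleGraph.deleteEdges_adj, Set.mem_singleton_iff, ne_eq]⟩
      refine .del hdel (ih hside ?_ ?_)
      · intro u v huv
        refine SimpleGraph.deleteEdges_adj.2 ⟨hle huv, fun h => heH ?_⟩
        rw [← Set.mem_singleton_iff.1 h]
        exact huv
      · have : G'.graph.edgeSet \ H.graph.edgeSet =
            (G.graph.edgeSet \ H.graph.edgeSet) \ {s(a, b)} := by
          ext e
          simp only [G', SimpleGraph.edgeSet_deleteEdges, Set.mem_sdiff]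
          tauto
        rw [this, Set.ncard_sdiff_singleton_of_mem (Set.mem_sdiff _ |>.2 ⟨heG, heH⟩), hd]
        rfl

/-- `D` dominates `G`: every vertex is in `D` or has a neighbor in `D`. -/
def IsDominating {V : Type} (G : BipGraph V) (D : Finset V) : Prop :=
  ∀ v, v ∈ D ∨ ∃ d ∈ D, G.graph.Adj v d

/-- A tree with a dominating set of size `c` becomes a disjoint union of stars by at most `c - 1`
edge deletions. -/
theorem exists_canBecomeBicluster_of_isDominating {V : Type} [Fintype V] {T : BipGraph V}
    (hT : T.graph.IsTree) (S : Set Side) {D : Finset V} (hD : T.IsDominating D) :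
    ∃ m ≤ D.card - 1, T.CanBecomeBicluster S m := by
  classical
  have hf : ∀ v, ∃ d ∈ D, (v ∈ D ∧ d = v) ∨ (v ∉ D ∧ T.graph.Adj v d) := by
    intro v
    by_cases hv : v ∈ D
    · exact ⟨v, hv, Or.inl ⟨hv, rfl⟩⟩
    · obtain h | ⟨d, hd, h⟩ := hD v
      · exact absurd h hv
      · exact ⟨d, hd, Or.inr ⟨hv, h⟩⟩
  choose f hfD hf using hf
  have hfix : ∀ v ∈ D, f v = v := fun v hv => by
    rcases hf v with h | h
    · exact h.2
    · exact absurd hv h.1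
  have hadj : ∀ v, f v ≠ v → v ∉ D ∧ T.graph.Adj v (f v) := fun v hv => by
    rcases hf v with h | h
    · exact absurd h.2 hv
    · exact h
  have hsub : ∀ u v, (u ≠ v ∧ (f u = v ∨ f v = u)) → T.graph.Adj u v := by
    rintro u v ⟨hne, rfl | rfl⟩
    · exact (hadj u hne.symm).2
    · exact (hadj v hne).2.symm
  let H : BipGraph V :=
    { graph := { Adj := fun u v => u ≠ v ∧ (f u = v ∨ f v = u)
                 symm := ⟨fun u v h => ⟨h.1.symm, h.2.symm⟩⟩
                 loopless := ⟨fun u h => h.1 rfl⟩ }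
      side := T.side
      side_ne := fun u v h => T.side_ne u v (hsub u v h) }
  have hle : H.graph ≤ T.graph := fun u v h => hsub u v h
  refine ⟨_, ?_, V, H, EditSeq.of_le rfl hle, ?_⟩
  · have h1 : T.graph.edgeSet.ncard + 1 = Fintype.card V := by
      rw [← hT.card_edgeFinset, ← SimpleGraph.coe_edgeFinset, Set.ncard_coe_finset]
    have h2 : (Finset.univ \ D).card ≤ H.graph.edgeSet.ncard := by
      rw [← Set.ncard_coe_finset]
      refine Set.ncard_le_ncard_of_injOn (fun v => s(v, f v)) ?_ ?_ (Set.toFinite _)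
      · intro v hv
        have hv : v ∉ D := by simpa using hv
        have hne : v ≠ f v := fun h => hv (by rw [h]; exact hfD v)
        exact ⟨hne, Or.inl rfl⟩
      · intro v hv w hw h
        have hv : v ∉ D := by simpa using hv
        rcases Sym2.eq_iff.1 h with h | h
        · exact h.1
        · exact absurd (h.1 ▸ hfD w) hv
    have h3 := Set.ncard_sdiff_add_ncard_of_subset (SimpleGraph.edgeSet_subset_edgeSet.2 hle)
      (Set.toFinite _)
    rw [Finset.card_sdiff_of_subset (Finset.subset_univ D), Finset.card_univ] at h2
    have h4 := Finset.card_le_univ D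
    omega
  · intro u v huv hne
    have hfuv : f u = f v := by
      obtain ⟨w⟩ := huv
      clear hne
      induction w with
      | nil => rfl
      | @cons a b c hab _ ih =>
        rw [← ih]
        rcases hab.2 with h | h
        · rw [← h, hfix _ (hfD a)]
        · rw [← h, hfix _ (hfD b)]
    have huv : u ≠ v := fun h => hne (h ▸ rfl)
    refine ⟨huv, ?_⟩
    by_contra hcon
    push Not at hcon
    have hu : f u ≠ u := fun h => hcon.2 (hfuv ▸ h)
    have hv : f v ≠ v := fun h => hcon.1 (hfuv.trans h)
    have h1 := T.side_ne _ _ (hadj u hu).2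
    have h2 := T.side_ne _ _ (hadj v hv).2
    rw [hfuv] at h1
    change T.side u ≠ T.side v at hne
    revert h1 h2 hne
    generalize T.side u = x
    generalize T.side v = y
    generalize T.side (f v) = z
    cases x <;> cases y <;> cases z <;> simp

end BipGraph

namespace BipGraph

/-- `p` is a parent function for `G`, with root the fixed point: the edges are the pairs of a
vertex and its parent, and every nonempty set has a member that is the root or whose parent is
outside. -/
structure IsParent {V : Type} (G : BipGraph V) (p : V → V) : Prop where
  parent : ∀ u v, G.graph.Adj u v → p u = v ∨ p v = u
  exists_top : ∀ S : Finset V, S.Nonempty → ∃ x ∈ S, p x = x ∨ p x ∉ S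

/-- `P` is a 2-packing: no vertex lies in two closed neighborhoods of members of `P`. -/
def IsPacking {V : Type} (G : BipGraph V) (P : Finset V) : Prop :=
  ∀ i ∈ P, ∀ j ∈ P, i ≠ j → ¬ G.graph.Adj i j ∧ ∀ w, ¬ (G.graph.Adj i w ∧ G.graph.Adj j w)

open scoped Classical in
theorem IsParent.card_edges_lt {V : Type} {G : BipGraph V} {p : V → V}
    (hp : G.IsParent p) {A B : Finset V} (hA : ∀ a ∈ A, G.side a = Side.A)
    (hB : ∀ b ∈ B, G.side b = Side.B) (hne : (A ∪ B).Nonempty) :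
    ((A ×ˢ B).filter fun q => G.graph.Adj q.1 q.2).card < A.card + B.card := by
  obtain ⟨x, hx, hxp⟩ := hp.exists_top _ hne
  have hlt : ((A ∪ B).erase x).card < A.card + B.card :=
    (Finset.card_erase_lt_of_mem hx).trans_le (Finset.card_union_le A B)
  refine lt_of_le_of_lt ?_ hlt
  have hpair : ∀ q ∈ (A ×ˢ B).filter fun q => G.graph.Adj q.1 q.2,
      q.1 ∈ A ∧ q.2 ∈ B ∧ G.graph.Adj q.1 q.2 := fun q hq => by
    simpa [and_assoc] using hq
  refine Finset.card_le_card_of_injOn (fun q => if p q.1 = q.2 then q.1 else q.2) ?_ ?_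
  · intro q hq
    obtain ⟨h1, h2, h3⟩ := hpair q hq
    have hne := h3.ne
    rw [Finset.mem_coe, Finset.mem_erase, Finset.mem_union]
    dsimp only
    split_ifs with h
    · refine ⟨?_, Or.inl h1⟩
      rintro rfl
      rcases hxp with hxp | hxp
      · exact hne (hxp.symm.trans h)
      · exact hxp (Finset.mem_union_right _ (h ▸ h2))
    · have h' : p q.2 = q.1 := (hp.parent _ _ h3).resolve_left h
      refine ⟨?_, Or.inr h2⟩
      rintro rfl
      rcases hxp with hxp | hxp
      · exact hne (h'.symm.trans hxp)
      · exact hxp (Finset.mem_union_left _ (h' ▸ h1))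
  · intro q hq q' hq' h
    obtain ⟨h1, h2, h3⟩ := hpair q hq
    obtain ⟨h1', h2', h3'⟩ := hpair q' hq'
    dsimp only at h
    split_ifs at h with c c' c'
    · exact Prod.ext h (by rw [← c, ← c', h])
    · have := hA _ h1; rw [h, hB _ h2'] at this; cases this
    · have := hB _ h2; rw [h, hA _ h1'] at this; cases this
    · exact Prod.ext (by rw [← (hp.parent _ _ h3).resolve_left c,
        ← (hp.parent _ _ h3').resolve_left c', h]) h

/-- A set with at most one member related to `w` has at most one more member than any set
containing its members unrelated to `w`. -/
theorem card_le_of_packing_side {V : Type} {R : V → V → Prop} {P : Finset V}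
    (w : V) (hP : ∀ i ∈ P, ∀ j ∈ P, R i w → R j w → i = j)
    {N : Finset V} (hN : ∀ i ∈ P, ¬ R i w → i ∈ N) : P.card ≤ N.card + 1 := by
  classical
  rw [← Finset.card_filter_add_card_filter_not (fun i => R i w)]
  have h1 : (P.filter fun i => R i w).card ≤ 1 := by
    rw [Finset.card_le_one]
    intro i hi j hj
    rw [Finset.mem_filter] at hi hj
    exact hP i hi.1 j hj.1 hi.2 hj.2
  have h2 : (P.filter fun i => ¬ R i w) ⊆ N := fun i hi => by
    rw [Finset.mem_filter] at hi
    exact hN i hi.1 hi.2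
  have := Finset.card_le_card h2
  omega

open scoped Classical in
theorem card_packing_step {V : Type} {G : BipGraph V} {p : V → V} (hp : G.IsParent p)
    {P : Finset V} (hP : G.IsPacking P) {A B X : Finset V} {U : Finset (V × V)}
    (hA : ∀ a ∈ A, G.side a = Side.A) (hB : ∀ b ∈ B, G.side b = Side.B)
    (hU : ∀ q ∈ U, q.1 ∈ X ∧ q.2 ∈ X) :
    ((P ∩ (A ∪ B)) \ X).card + (((A ×ˢ B) \ U).filter fun q => G.graph.Adj q.1 q.2).card ≤
      A.card + B.card + (((A ×ˢ B) \ U).filter fun q => ¬ G.graph.Adj q.1 q.2).card := by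
  have hPX : ((P ∩ (A ∪ B)) \ X).card ≤ ((P ∩ A) \ X).card + ((P ∩ B) \ X).card := by
    rw [Finset.inter_union_distrib_left, Finset.union_sdiff_distrib]
    exact Finset.card_union_le _ _
  have hPA : ((P ∩ A) \ X).card ≤ A.card :=
    Finset.card_le_card (Finset.sdiff_subset.trans Finset.inter_subset_right)
  have hPB : ((P ∩ B) \ X).card ≤ B.card :=
    Finset.card_le_card (Finset.sdiff_subset.trans Finset.inter_subset_right)
  have hE : (((A ×ˢ B) \ U).filter fun q => G.graph.Adj q.1 q.2).card ≤
      ((A ×ˢ B).filter fun q => G.graph.Adj q.1 q.2).card :=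
    Finset.card_le_card (Finset.filter_subset_filter _ Finset.sdiff_subset)
  rcases A.eq_empty_or_nonempty with rfl | ⟨a, ha⟩
  · simp only [Finset.empty_product, Finset.filter_empty, Finset.card_empty] at *
    omega
  rcases B.eq_empty_or_nonempty with rfl | ⟨b, hb⟩
  · simp only [Finset.product_empty, Finset.filter_empty, Finset.card_empty] at *
    omega
  have hlt := hp.card_edges_lt hA hB ⟨a, Finset.mem_union_left _ ha⟩
  set N := ((A ×ˢ B) \ U).filter fun q => ¬ G.graph.Adj q.1 q.2 with hN
  suffices h : ((P ∩ A) \ X).card + ((P ∩ B) \ X).card ≤ N.card + 1 by omega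
  have memN : ∀ x y, x ∈ A → y ∈ B → (x ∉ X ∨ y ∉ X) → ¬ G.graph.Adj x y → (x, y) ∈ N := by
    intro x y hx hy hxy h
    refine Finset.mem_filter.2 ⟨Finset.mem_sdiff.2 ⟨Finset.mk_mem_product hx hy, fun hm => ?_⟩, h⟩
    have := hU _ hm
    tauto
  have uniq : ∀ w, ∀ i ∈ P, ∀ j ∈ P, G.graph.Adj i w → G.graph.Adj j w → i = j := by
    intro w i hi j hj h1 h2
    by_contra hij
    exact (hP i hi j hj hij).2 w ⟨h1, h2⟩
  have mem : ∀ {Y : Finset V} {x : V}, x ∈ (P ∩ Y) \ X → x ∈ P ∧ x ∈ Y ∧ x ∉ X := by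
    intro Y x hx
    simpa [and_assoc] using hx
  by_cases hPA0 : ((P ∩ A) \ X).card = 0
  · rw [hPA0, zero_add]
    refine (card_le_of_packing_side (R := fun i w => G.graph.Adj i w) a
      (N := N.image Prod.snd) ?_ ?_).trans
      (Nat.add_le_add_right Finset.card_image_le 1)
    · exact fun i hi j hj => uniq a i (mem hi).1 j (mem hj).1
    · exact fun i hi h => Finset.mem_image.2 ⟨(a, i), memN a i ha (mem hi).2.1
        (Or.inr (mem hi).2.2) fun h' => h h'.symm, rfl⟩
  by_cases hPB0 : ((P ∩ B) \ X).card = 0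
  · rw [hPB0, add_zero]
    refine (card_le_of_packing_side (R := fun i w => G.graph.Adj i w) b
      (N := N.image Prod.fst) ?_ ?_).trans
      (Nat.add_le_add_right Finset.card_image_le 1)
    · exact fun i hi j hj => uniq b i (mem hi).1 j (mem hj).1
    · exact fun i hi h => Finset.mem_image.2 ⟨(i, b), memN i b (mem hi).2.1 hb
        (Or.inl (mem hi).2.2) h, rfl⟩
  have hsub : ((P ∩ A) \ X) ×ˢ ((P ∩ B) \ X) ⊆ N := by
    rintro ⟨x, y⟩ hxy
    obtain ⟨hx, hy⟩ := Finset.mem_product.1 hxy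
    obtain ⟨hx1, hx2, hx3⟩ := mem hx
    obtain ⟨hy1, hy2, hy3⟩ := mem hy
    refine memN x y hx2 hy2 (Or.inl hx3) (hP x hx1 y hy1 ?_).1
    rintro rfl
    have := hA _ hx2
    rw [hB _ hy2] at this
    cases this
  have hcard := Finset.card_le_card hsub
  rw [Finset.card_product] at hcard
  obtain ⟨i, hi⟩ := Nat.exists_eq_succ_of_ne_zero hPA0
  obtain ⟨j, hj⟩ := Nat.exists_eq_succ_of_ne_zero hPB0
  rw [hi, hj] at hcard ⊢
  simp only [Nat.succ_eq_add_one] at *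
  nlinarith [Nat.zero_le (i * j)]

open scoped Classical in
theorem card_packing_family {V ι : Type} {G : BipGraph V} {p : V → V} (hp : G.IsParent p)
    {P : Finset V} (hP : G.IsPacking P) {A B : ι → Finset V}
    (hA : ∀ i, ∀ a ∈ A i, G.side a = Side.A) (hB : ∀ i, ∀ b ∈ B i, G.side b = Side.B)
    (s : Finset ι) :
    (P ∩ s.biUnion fun i => A i ∪ B i).card +
        ((s.biUnion fun i => A i ×ˢ B i).filter fun q => G.graph.Adj q.1 q.2).card ≤
      ∑ i ∈ s, ((A i).card + (B i).card) +
        ((s.biUnion fun i => A i ×ˢ B i).filter fun q => ¬ G.graph.Adj q.1 q.2).card := by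
  induction s using Finset.induction_on with
  | empty => simp
  | insert c s hc ih =>
    rw [Finset.sum_insert hc, Finset.biUnion_insert, Finset.biUnion_insert]
    set X := s.biUnion fun i => A i ∪ B i
    set U := s.biUnion fun i => A i ×ˢ B i
    have hU : ∀ q ∈ U, q.1 ∈ X ∧ q.2 ∈ X := by
      intro q hq
      obtain ⟨i, hi, hq⟩ := Finset.mem_biUnion.1 hq
      obtain ⟨h1, h2⟩ := Finset.mem_product.1 hq
      exact ⟨Finset.mem_biUnion.2 ⟨i, hi, Finset.mem_union_left _ h1⟩,
        Finset.mem_biUnion.2 ⟨i, hi, Finset.mem_union_right _ h2⟩⟩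
    have step := card_packing_step hp hP (hA c) (hB c) hU
    have split : ∀ (r : V × V → Prop) [DecidablePred r], ((A c ×ˢ B c ∪ U).filter r).card =
        ((A c ×ˢ B c \ U).filter r).card + (U.filter r).card := by
      intro r _
      rw [← Finset.sdiff_union_self_eq_union, Finset.filter_union, Finset.card_union_of_disjoint]
      exact Finset.disjoint_filter_filter Finset.sdiff_disjoint
    have splitP : (P ∩ (A c ∪ B c ∪ X)).card = ((P ∩ (A c ∪ B c)) \ X).card + (P ∩ X).card := by
      have : P ∩ (A c ∪ B c ∪ X) = ((P ∩ (A c ∪ B c)) \ X) ∪ (P ∩ X) := by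
        ext v; simp only [Finset.mem_inter, Finset.mem_union, Finset.mem_sdiff]; tauto
      rw [this, Finset.card_union_of_disjoint]
      rw [Finset.disjoint_left]
      intro v h1 h2
      exact (Finset.mem_sdiff.1 h1).2 (Finset.mem_inter.1 h2).2
    rw [split, split, splitP]
    omega

open scoped Classical in
theorem card_oriented_edges {V : Type} [Fintype V] {T : BipGraph V} (hT : T.graph.IsTree) :
    (Finset.univ.filter fun q : V × V => (T.side q.1 = Side.A ∧ T.side q.2 = Side.B) ∧
      T.graph.Adj q.1 q.2).card + 1 = Fintype.card V := by
  rw [← hT.card_edgeFinset]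
  congr 1
  refine Finset.card_bij (fun q _ => s(q.1, q.2)) ?_ ?_ ?_
  · intro q hq
    simpa using (Finset.mem_filter.1 hq).2.2
  · intro q hq q' hq' h
    exact eq_of_oriented T (Finset.mem_filter.1 hq).2.1.1 (Finset.mem_filter.1 hq').2.1.2 h
  · intro e he
    induction e using Sym2.ind with
    | _ a b =>
      have hab : T.graph.Adj a b := by simpa using he
      obtain ⟨c, d, hc, hd, h⟩ := exists_oriented T (T.side_ne a b hab)
      refine ⟨(c, d), Finset.mem_filter.2 ⟨Finset.mem_univ _, ⟨hc, hd⟩, ?_⟩, h⟩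
      have : s(c, d) ∈ T.graph.edgeSet := h ▸ hab
      exact this

/-- Every packing of a tree has at most one more member than there are operations. -/
theorem IsPacking.card_le_of_canBecomeBicluster {V : Type} [Fintype V] {T : BipGraph V}
    (hT : T.graph.IsTree) {p : V → V} (hp : T.IsParent p) {P : Finset V} (hP : T.IsPacking P)
    {S : Set Side} {m : ℕ} (h : T.CanBecomeBicluster S m) : P.card ≤ m + 1 := by
  classical
  obtain ⟨W, H, hseq, hH⟩ := h
  obtain ⟨hW, φ, hφ, hside, hle⟩ := hseq.exists_projection inferInstance
  have := Fintype.ofFinite W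
  let C := H.graph.ConnectedComponent
  have : Fintype C := Fintype.ofFinite C
  let A' : C → Finset W := fun c =>
    Finset.univ.filter fun w => H.graph.connectedComponentMk w = c ∧ H.side w = Side.A
  let B' : C → Finset W := fun c =>
    Finset.univ.filter fun w => H.graph.connectedComponentMk w = c ∧ H.side w = Side.B
  have memA : ∀ {c w}, w ∈ A' c ↔ H.graph.connectedComponentMk w = c ∧ H.side w = Side.A := by
    intro c w; simp [A']
  have memB : ∀ {c w}, w ∈ B' c ↔ H.graph.connectedComponentMk w = c ∧ H.side w = Side.B := by
    intro c w; simp [B']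
  have fam := card_packing_family hp hP (A := fun c => (A' c).image φ)
    (B := fun c => (B' c).image φ)
    (by
      intro c a ha
      obtain ⟨w, hw, rfl⟩ := Finset.mem_image.1 ha
      rw [← hside]; exact (memA.1 hw).2)
    (by
      intro c a ha
      obtain ⟨w, hw, rfl⟩ := Finset.mem_image.1 ha
      rw [← hside]; exact (memB.1 hw).2) Finset.univ
  set U := Finset.univ.biUnion fun c => (A' c).image φ ×ˢ (B' c).image φ with hU
  have hX : P ∩ (Finset.univ.biUnion fun c => (A' c).image φ ∪ (B' c).image φ) = P := by
    refine Finset.inter_eq_left.2 fun v _ => ?_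
    obtain ⟨w, rfl⟩ := hφ v
    refine Finset.mem_biUnion.2 ⟨H.graph.connectedComponentMk w, Finset.mem_univ _, ?_⟩
    rw [Finset.mem_union]
    cases hw : H.side w
    · exact Or.inl (Finset.mem_image_of_mem _ (memA.2 ⟨rfl, hw⟩))
    · exact Or.inr (Finset.mem_image_of_mem _ (memB.2 ⟨rfl, hw⟩))
  have hsum : ∑ c, (((A' c).image φ).card + ((B' c).image φ).card) ≤ Nat.card W := by
    calc ∑ c, (((A' c).image φ).card + ((B' c).image φ).card)
        ≤ ∑ c, (A' c ∪ B' c).card := by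
          refine Finset.sum_le_sum fun c _ => ?_
          rw [Finset.card_union_of_disjoint]
          · exact Nat.add_le_add Finset.card_image_le Finset.card_image_le
          · rw [Finset.disjoint_left]
            intro w h1 h2
            have := (memA.1 h1).2
            rw [(memB.1 h2).2] at this
            cases this
      _ = (Finset.univ.biUnion fun c => A' c ∪ B' c).card := by
          rw [Finset.card_biUnion]
          intro c _ d _ hcd
          simp only [Function.onFun]
          rw [Finset.disjoint_left]
          intro w h1 h2
          rw [Finset.mem_union, memA, memB] at h1 h2
          refine hcd ?_
          rw [← (show H.graph.connectedComponentMk w = c by tauto)]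
          tauto
      _ ≤ Nat.card W := by
          rw [Nat.card_eq_fintype_card]
          exact Finset.card_le_univ _
  have hcov : ∀ a b, H.side a = Side.A → H.side b = Side.B → H.graph.Adj a b →
      (φ a, φ b) ∈ U := by
    intro a b ha hb hab
    refine Finset.mem_biUnion.2 ⟨H.graph.connectedComponentMk a, Finset.mem_univ _,
      Finset.mk_mem_product (Finset.mem_image_of_mem _ (memA.2 ⟨rfl, ha⟩))
      (Finset.mem_image_of_mem _ (memB.2 ⟨?_, hb⟩))⟩
    exact SimpleGraph.ConnectedComponent.sound hab.symm.reachable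
  have hN : (U.filter fun q => ¬ T.graph.Adj q.1 q.2).card ≤ (surplus T H φ).ncard := by
    rw [← Set.ncard_coe_finset]
    refine Set.ncard_le_ncard ?_ (Set.toFinite _)
    intro q hq
    obtain ⟨hq, hn⟩ := Finset.mem_filter.1 hq
    obtain ⟨c, -, hq⟩ := Finset.mem_biUnion.1 hq
    obtain ⟨hq1, hq2⟩ := Finset.mem_product.1 hq
    obtain ⟨a, ha, ha'⟩ := Finset.mem_image.1 hq1
    obtain ⟨b, hb, hb'⟩ := Finset.mem_image.1 hq2
    obtain ⟨hac, ha⟩ := memA.1 ha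
    obtain ⟨hbc, hb⟩ := memB.1 hb
    refine ⟨⟨by rw [← ha', ← hside, ha], by rw [← hb', ← hside, hb]⟩, hn, a, b, ha', hb', ?_⟩
    refine hH a b (SimpleGraph.ConnectedComponent.exact (hac.trans hbc.symm)) ?_
    rw [ha, hb]; simp
  have hE : (Finset.univ.filter fun q : V × V => (T.side q.1 = Side.A ∧ T.side q.2 = Side.B) ∧
      T.graph.Adj q.1 q.2).card ≤ (U.filter fun q => T.graph.Adj q.1 q.2).card +
        (uncovered T H φ).ncard := by
    rw [← Set.ncard_coe_finset, ← Set.ncard_coe_finset]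
    refine (Set.ncard_le_ncard ?_ (Set.toFinite _)).trans (Set.ncard_union_le _ _)
    intro q hq
    obtain ⟨-, hq1, hq2⟩ := Finset.mem_filter.1 hq
    by_cases hc : ∃ a b, φ a = q.1 ∧ φ b = q.2 ∧ H.graph.Adj a b
    · obtain ⟨a, b, ha, hb, hab⟩ := hc
      refine Or.inl (Finset.mem_coe.2 (Finset.mem_filter.2 ⟨?_, hq2⟩))
      have := hcov a b (by rw [hside, ha, hq1.1]) (by rw [hside, hb, hq1.2]) hab
      rwa [ha, hb] at this
    · exact Or.inr ⟨hq1, hq2, fun a b ha hb hab => hc ⟨a, b, ha, hb, hab⟩⟩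
  have hcard := card_oriented_edges hT
  rw [hX] at fam
  rw [Nat.card_eq_fintype_card (α := V)] at hle
  omega

/-- A dominating set and a packing of the same size determine the optimum on a tree. -/
theorem exists_canBecomeBicluster_iff {V : Type} [Fintype V] {T : BipGraph V}
    (hT : T.graph.IsTree) {p : V → V} (hp : T.IsParent p) {D P : Finset V}
    (hD : T.IsDominating D) (hP : T.IsPacking P) (hcard : D.card = P.card) (S : Set Side) (k : ℕ) :
    (∃ m ≤ k, T.CanBecomeBicluster S m) ↔ P.card - 1 ≤ k := by
  constructor
  · rintro ⟨m, hm, h⟩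
    have := hP.card_le_of_canBecomeBicluster hT hp h
    omega
  · intro h
    obtain ⟨m, hm, h'⟩ := exists_canBecomeBicluster_of_isDominating hT S hD
    exact ⟨m, by omega, h'⟩

end BipGraph

/-- The vertices of `l`, newest first, have been attached one after the other: the last entry of
the list is the root, and the parent of every other entry comes after it. -/
def Grown {V : Type} (G : SimpleGraph V) (p : V → V) : List V → Prop
  | [] => True
  | y :: l => y ∉ l ∧ (l = [] → p y = y) ∧ (l ≠ [] → p y ∈ l ∧ G.Adj y (p y)) ∧ Grown G p l

namespace Grown

variable {V : Type} {G : SimpleGraph V} {p q : V → V} {l : List V}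

theorem nodup : ∀ {l : List V}, Grown G p l → l.Nodup
  | [], _ => List.nodup_nil
  | _ :: _, h => List.nodup_cons.2 ⟨h.1, h.2.2.2.nodup⟩

theorem parent_mem : ∀ {l : List V}, Grown G p l → ∀ x ∈ l, p x ∈ l
  | y :: l, h, x, hx => by
    rcases List.mem_cons.1 hx with rfl | hx
    · by_cases hl : l = []
      · rw [h.2.1 hl]; exact List.mem_cons_self
      · exact List.mem_cons_of_mem _ (h.2.2.1 hl).1
    · exact List.mem_cons_of_mem _ (h.2.2.2.parent_mem x hx)

theorem eq_or_adj : ∀ {l : List V}, Grown G p l → ∀ x ∈ l, p x = x ∨ G.Adj x (p x)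
  | y :: l, h, x, hx => by
    rcases List.mem_cons.1 hx with rfl | hx
    · by_cases hl : l = []
      · exact Or.inl (h.2.1 hl)
      · exact Or.inr (h.2.2.1 hl).2
    · exact h.2.2.2.eq_or_adj x hx

theorem congr : ∀ {l : List V}, (∀ x ∈ l, p x = q x) → Grown G p l → Grown G q l
  | [], _, _ => trivial
  | y :: l, hpq, h => by
    have hy := hpq y List.mem_cons_self
    exact ⟨h.1, by rw [← hy]; exact h.2.1, by rw [← hy]; exact h.2.2.1,
      congr (fun x hx => hpq x (List.mem_cons_of_mem _ hx)) h.2.2.2⟩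

theorem cons_update [DecidableEq V] {x y : V} (h : Grown G p l) (hx : x ∈ l) (hy : y ∉ l)
    (hxy : G.Adj y x) : Grown G (Function.update p y x) (y :: l) := by
  refine ⟨hy, ?_, ?_, h.congr fun z hz => ?_⟩
  · rintro rfl
    simp at hx
  · intro _
    rw [Function.update_self]
    exact ⟨hx, hxy⟩
  · rw [Function.update_of_ne]
    rintro rfl
    exact hy hz

theorem exists_top (S : Finset V) : ∀ {l : List V}, Grown G p l → (∃ x ∈ l, x ∈ S) →
    ∃ x ∈ S, p x = x ∨ (p x ∉ S)
  | y :: l, h, ⟨x, hx, hxS⟩ => by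
    by_cases hl : ∃ x ∈ l, x ∈ S
    · exact h.2.2.2.exists_top S hl
    · rcases List.mem_cons.1 hx with rfl | hx
      · refine ⟨x, hxS, ?_⟩
        by_cases h0 : l = []
        · exact Or.inl (h.2.1 h0)
        · exact Or.inr fun h' => hl ⟨_, (h.2.2.1 h0).1, h'⟩
      · exact absurd ⟨x, hx, hxS⟩ hl

theorem exists_edges : ∀ {l : List V}, Grown G p l → l ≠ [] →
    ∃ F : Finset (Sym2 V), F.card + 1 = l.length ∧ ∀ e ∈ F, ∃ v ∈ l, e = s(v, p v) ∧ G.Adj v (p v)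
  | y :: l, h, _ => by
    classical
    by_cases hl : l = []
    · subst hl
      exact ⟨∅, rfl, by simp⟩
    · obtain ⟨F, hF, hFl⟩ := h.2.2.2.exists_edges hl
      refine ⟨insert s(y, p y) F, ?_, ?_⟩
      · rw [Finset.card_insert_of_notMem, hF, List.length_cons]
        intro hm
        obtain ⟨v, hv, he, -⟩ := hFl _ hm
        rcases Sym2.eq_iff.1 he with ⟨rfl, -⟩ | ⟨rfl, -⟩
        · exact h.1 hv
        · exact h.1 (h.2.2.2.parent_mem v hv)
      · intro e he
        rcases Finset.mem_insert.1 he with rfl | he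
        · exact ⟨y, List.mem_cons_self, rfl, (h.2.2.1 hl).2⟩
        · obtain ⟨v, hv, h'⟩ := hFl e he
          exact ⟨v, List.mem_cons_of_mem _ hv, h'⟩

theorem isParent [Fintype V] {T : BipGraph V} (hT : T.graph.IsTree) (h : Grown T.graph p l)
    (hl : ∀ v, v ∈ l) : T.IsParent p := by
  classical
  refine ⟨fun u v huv => ?_, fun S ⟨x, hx⟩ => h.exists_top S ⟨x, hl x, hx⟩⟩
  obtain ⟨F, hF, hFl⟩ := h.exists_edges (List.ne_nil_of_mem (hl u))
  have hlen : l.length = Fintype.card V := by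
    rw [← List.toFinset_card_of_nodup h.nodup, ← Finset.card_univ]
    congr 1
    ext v
    simp [hl]
  have hsub : F ⊆ T.graph.edgeFinset := by
    intro e he
    obtain ⟨v, -, rfl, hv⟩ := hFl e he
    simpa using hv
  have heq : F = T.graph.edgeFinset := by
    refine Finset.eq_of_subset_of_card_le hsub ?_
    have := hT.card_edgeFinset
    omega
  have : s(u, v) ∈ F := by rw [heq]; simpa using huv
  obtain ⟨w, -, hw, -⟩ := hFl _ this
  rcases Sym2.eq_iff.1 hw with ⟨rfl, rfl⟩ | ⟨rfl, rfl⟩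
  · exact Or.inl rfl
  · exact Or.inr rfl

/-- A grown list that no edge leaves contains every vertex. -/
theorem mem_of_closed (hG : G.Connected) {r : V} (hr : r ∈ l)
    (hcl : ∀ u v, G.Adj u v → (u ∈ l ↔ v ∈ l)) (v : V) : v ∈ l := by
  obtain ⟨w⟩ := hG.preconnected r v
  induction w with
  | nil => exact hr
  | cons h _ ih => exact ih ((hcl _ _ h).1 hr)

end Grown

/-- State of the greedy algorithm that has still to visit the vertices in `l`: `D` dominates the
visited vertices and `P` is a packing of visited vertices, of the same size. -/
structure Greedy {V : Type} (T : BipGraph V) (p : V → V) (l : List V) (D P : Finset V) : Prop where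
  dominated : ∀ v, v ∉ l → p v ∈ D ∨ v ∈ D ∨ ∃ c ∈ D, p c = v
  visited : ∀ i ∈ P, i ∉ l
  parent_mem : ∀ i ∈ P, p i ∈ D
  packing : T.IsPacking P
  card : D.card = P.card

namespace Greedy

variable {V : Type} {T : BipGraph V} {p : V → V} {l : List V} {D P : Finset V} {v : V}

theorem skip (h : Greedy T p (v :: l) D P) (hv : p v ∈ D ∨ v ∈ D ∨ ∃ c ∈ D, p c = v) :
    Greedy T p l D P where
  dominated u hu := by
    by_cases huv : u = v
    · rw [huv]; exact hv
    · exact h.dominated u (by simp [huv, hu])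
  visited i hi hl := h.visited i hi (List.mem_cons_of_mem _ hl)
  parent_mem := h.parent_mem
  packing := h.packing
  card := h.card

theorem take [DecidableEq V] (hp : T.IsParent p) (hl : Grown T.graph p (v :: l))
    (h : Greedy T p (v :: l) D P) (h1 : p v ∉ D) (h2 : ¬ (v ∈ D ∨ ∃ c ∈ D, p c = v)) :
    Greedy T p l (insert (p v) D) (insert v P) where
  dominated u hu := by
    by_cases huv : u = v
    · exact Or.inl (by rw [huv]; exact Finset.mem_insert_self _ _)
    · rcases h.dominated u (by simp [huv, hu]) with h | h | ⟨c, hc, h⟩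
      · exact Or.inl (Finset.mem_insert_of_mem h)
      · exact Or.inr (Or.inl (Finset.mem_insert_of_mem h))
      · exact Or.inr (Or.inr ⟨c, Finset.mem_insert_of_mem hc, h⟩)
  visited i hi hil := by
    rcases Finset.mem_insert.1 hi with rfl | hi
    · exact hl.1 hil
    · exact h.visited i hi (List.mem_cons_of_mem _ hil)
  parent_mem i hi := by
    rcases Finset.mem_insert.1 hi with rfl | hi
    · exact Finset.mem_insert_self _ _
    · exact Finset.mem_insert_of_mem (h.parent_mem i hi)
  packing := by
    have nadj : ∀ i ∈ P, ¬ T.graph.Adj i v := by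
      intro i hi hiv
      rcases hp.parent _ _ hiv with e | e
      · exact h2 (Or.inl (e ▸ h.parent_mem i hi))
      · exact h.visited i hi (e ▸ hl.parent_mem v List.mem_cons_self)
    have far : ∀ i ∈ P, ∀ w, ¬ (T.graph.Adj i w ∧ T.graph.Adj v w) := by
      rintro i hi w ⟨hiw, hvw⟩
      rcases hp.parent _ _ hvw with e | e <;> rcases hp.parent _ _ hiw with e' | e'
      · exact h1 (e ▸ e' ▸ h.parent_mem i hi)
      · exact h.visited i hi
          (e' ▸ hl.parent_mem w (e ▸ hl.parent_mem v List.mem_cons_self))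
      · exact h2 (Or.inr ⟨w, e' ▸ h.parent_mem i hi, e⟩)
      · exact h.visited i hi (e' ▸ e ▸ List.mem_cons_self)
    intro i hi j hj hij
    rcases Finset.mem_insert.1 hi with hi' | hi' <;> rcases Finset.mem_insert.1 hj with hj' | hj'
    · exact absurd (hi'.trans hj'.symm) hij
    · exact hi' ▸ ⟨fun h => nadj j hj' h.symm, fun w hw => far j hj' w hw.symm⟩
    · exact hj' ▸ ⟨nadj i hi', far i hi'⟩
    · exact h.packing i hi' j hj' hij
  card := by
    rw [Finset.card_insert_of_notMem h1, Finset.card_insert_of_notMem, h.card]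
    exact fun hv => h.visited v hv List.mem_cons_self

theorem isDominating (h : Greedy T p [] D P) (hp : ∀ v, p v = v ∨ T.graph.Adj v (p v)) :
    T.IsDominating D := by
  intro v
  rcases h.dominated v List.not_mem_nil with hv | hv | ⟨c, hc, rfl⟩
  · rcases hp v with e | e
    · exact Or.inl (e ▸ hv)
    · exact Or.inr ⟨_, hv, e⟩
  · exact Or.inl hv
  · rcases hp c with e | e
    · exact Or.inl (e.symm ▸ hc)
    · exact Or.inr ⟨c, hc, e.symm⟩

end Greedy

namespace RAM

open scoped Classical in
/-- Final state of a program without loops. -/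
noncomputable def Prog.eval : Prog → State → State
  | .instr c, s => c.apply s
  | .seq P Q, s => Q.eval (P.eval s)
  | .ite b P Q, s => if b.Holds s then P.eval s else Q.eval s
  | .loop _ _, s => s

/-- Bound on the number of steps of a program without loops. -/
def Prog.cost : Prog → ℕ
  | .instr _ => 1
  | .seq P Q => P.cost + Q.cost
  | .ite _ P Q => P.cost + Q.cost + 1
  | .loop _ _ => 0

def Prog.LoopFree : Prog → Prop
  | .instr _ => True
  | .seq P Q => P.LoopFree ∧ Q.LoopFree
  | .ite _ P Q => P.LoopFree ∧ Q.LoopFree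
  | .loop _ _ => False

theorem Prog.LoopFree.exec : ∀ {P : Prog}, P.LoopFree → ∀ s : State,
    ∃ t ≤ P.cost, Exec P s t (P.eval s)
  | .instr c, _, s => ⟨1, le_rfl, .instr c s⟩
  | .seq P Q, h, s => by
    obtain ⟨t, ht, h1⟩ := h.1.exec s
    obtain ⟨u, hu, h2⟩ := h.2.exec (P.eval s)
    exact ⟨t + u, Nat.add_le_add ht hu, .seq h1 h2⟩
  | .ite b P Q, h, s => by
    by_cases hb : b.Holds s
    · obtain ⟨t, ht, h1⟩ := h.1.exec s
      refine ⟨t + 1, by simp only [Prog.cost]; omega, ?_⟩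
      rw [Prog.eval, if_pos hb]
      exact .ite_true hb h1
    · obtain ⟨t, ht, h1⟩ := h.2.exec s
      refine ⟨t + 1, by simp only [Prog.cost]; omega, ?_⟩
      rw [Prog.eval, if_neg hb]
      exact .ite_false hb h1

/-- A loop with invariant `I`, variant `μ` and a body without loops. -/
theorem Exec.exists_loop {b : Test} {P : Prog} (hP : P.LoopFree) (I : State → Prop)
    (μ : State → ℕ) (step : ∀ s, I s → b.Holds s → I (P.eval s) ∧ μ (P.eval s) < μ s)
    (s : State) (hs : I s) :
    ∃ t s', Exec (.loop b P) s t s' ∧ t ≤ (P.cost + 1) * μ s + 1 ∧ I s' ∧ ¬ b.Holds s' := by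
  induction hm : μ s using Nat.strong_induction_on generalizing s with
  | _ m ih =>
    subst hm
    by_cases hb : b.Holds s
    · obtain ⟨hI, hlt⟩ := step s hs hb
      obtain ⟨t, ht, h1⟩ := hP.exec s
      obtain ⟨u, s', h2, hu, hI', hb'⟩ := ih _ hlt (P.eval s) hI rfl
      refine ⟨t + u + 1, s', .loop_true hb h1 h2, ?_, hI', hb'⟩
      have := Nat.mul_le_mul_left (P.cost + 1) (Nat.succ_le_of_lt hlt)
      rw [Nat.succ_eq_add_one, Nat.mul_add, Nat.mul_one] at this
      omega
    · exact ⟨1, s, .loop_false hb, by omega, hs, hb⟩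

/-- `a` holds the entries of the list from its end to its beginning. -/
def Stored {n : ℕ} (a : ℕ → ℕ) : List (Fin n) → Prop
  | [] => True
  | y :: l => a l.length = y ∧ Stored a l

theorem Stored.update {n : ℕ} {a : ℕ → ℕ} {i x : ℕ} : ∀ {l : List (Fin n)}, l.length ≤ i →
    Stored a l → Stored (Function.update a i x) l
  | [], _, _ => trivial
  | y :: l, hi, h => by
    rw [List.length_cons] at hi
    refine ⟨?_, h.2.update (by omega)⟩
    rw [Function.update_of_ne (by omega)]
    exact h.1

/-- Marks vertex `0` as visited. -/
def growInit : Prog :=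
  .seq (.instr (.const 9 1)) (.seq (.instr (.store 3 10 9)) (.instr (.const 3 1)))

/-- Looks at one edge: if exactly one endpoint has been visited, the other one is appended to the
order, with the first as its parent, and the scan of the edges restarts. -/
def growBody : Prog :=
  .seq (.instr (.load 5 1 4)) <| .seq (.instr (.load 6 2 4)) <|
  .seq (.instr (.load 7 3 5)) <| .seq (.instr (.load 8 3 6)) <|
  .ite (.eq 7 8) (.instr (.succ 4)) <|
  .seq (.ite (.lt 7 8)
    (.seq (.instr (.move 11 5)) (.seq (.instr (.move 5 6)) (.instr (.move 6 11))))
    (.instr (.const 11 0))) <|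
  .seq (.instr (.store 3 6 9)) <| .seq (.instr (.store 4 3 6)) <|
  .seq (.instr (.store 5 6 5)) <| .seq (.instr (.succ 3)) (.instr (.const 4 0))

/-- Visits the last unvisited vertex: if it is undominated, its parent is selected. -/
def greedyBody : Prog :=
  .seq (.instr (.pred 3)) <| .seq (.instr (.load 5 4 3)) <| .seq (.instr (.load 6 5 5)) <|
  .seq (.instr (.load 7 6 5)) <| .seq (.instr (.load 8 7 6)) <|
  .ite (.eq 7 10)
    (.ite (.eq 8 10)
      (.seq (.instr (.store 7 6 9)) <| .seq (.instr (.store 6 6 9)) <|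
        .seq (.instr (.load 11 5 6)) <| .seq (.instr (.store 6 11 9)) (.instr (.succ 13)))
      (.instr (.const 11 0)))
    (.instr (.const 11 0))

/-- The invariant of the first loop. -/
structure GrowInv {n : ℕ} (T : BipGraph (Fin n)) (L : List (Fin n × Fin n)) (k : ℕ)
    (l : List (Fin n)) (p : Fin n → Fin n) (s : State) : Prop where
  reg_n : s.reg 0 = n
  reg_k : s.reg 2 = k
  reg_len : s.reg 3 = l.length
  reg_edge : s.reg 4 ≤ L.length
  reg_one : s.reg 9 = 1
  reg_zero : s.reg 10 = 0
  reg_count : s.reg 13 = 0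
  fst : ∀ i (h : i < L.length), s.arr 1 i = L[i].1
  snd : ∀ i (h : i < L.length), s.arr 2 i = L[i].2
  visited : ∀ v : Fin n, s.arr 3 v = if v ∈ l then 1 else 0
  stored : Stored (s.arr 4) l
  par : ∀ v : Fin n, s.arr 5 v = p v
  arr_six : ∀ i, s.arr 6 i = 0
  arr_seven : ∀ i, s.arr 7 i = 0
  ne_nil : l ≠ []
  grown : Grown T.graph p l
  closed : ∀ i (h : i < L.length), i < s.reg 4 → (L[i].1 ∈ l ↔ L[i].2 ∈ l)

theorem GrowInv.init {n : ℕ} (hn : 0 < n) (T : BipGraph (Fin n)) (L : List (Fin n × Fin n))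
    (k : ℕ) : GrowInv T L k [⟨0, hn⟩] (fun _ => ⟨0, hn⟩) (growInit.eval (inputState T L k)) where
  reg_n := by simp [growInit, Prog.eval, Instr.apply, State.setReg, State.setArr, inputState]
  reg_k := by simp [growInit, Prog.eval, Instr.apply, State.setReg, State.setArr, inputState]
  reg_len := by simp [growInit, Prog.eval, Instr.apply, State.setReg, State.setArr]
  reg_edge := by simp [growInit, Prog.eval, Instr.apply, State.setReg, State.setArr, inputState]
  reg_one := by simp [growInit, Prog.eval, Instr.apply, State.setReg, State.setArr]
  reg_zero := by simp [growInit, Prog.eval, Instr.apply, State.setReg, State.setArr, inputState]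
  reg_count := by simp [growInit, Prog.eval, Instr.apply, State.setReg, State.setArr, inputState]
  fst i h := by
    simp [growInit, Prog.eval, Instr.apply, State.setReg, State.setArr, inputState, h]
  snd i h := by
    simp [growInit, Prog.eval, Instr.apply, State.setReg, State.setArr, inputState, h]
  visited v := by
    simp [growInit, Prog.eval, Instr.apply, State.setReg, State.setArr, inputState,
      Function.update_apply, Fin.ext_iff]
  stored := by
    simp [growInit, Prog.eval, Instr.apply, State.setReg, State.setArr, inputState, Stored]
  par v := by simp [growInit, Prog.eval, Instr.apply, State.setReg, State.setArr, inputState]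
  arr_six i := by simp [growInit, Prog.eval, Instr.apply, State.setReg, State.setArr, inputState]
  arr_seven i := by simp [growInit, Prog.eval, Instr.apply, State.setReg, State.setArr, inputState]
  ne_nil := by simp
  grown := by simp [Grown]
  closed i h hi := by
    simp [growInit, Prog.eval, Instr.apply, State.setReg, State.setArr, inputState] at hi

/-- The state after a vertex `y` has been attached to a vertex `x`. -/
theorem GrowInv.attach {n : ℕ} {T : BipGraph (Fin n)} {L : List (Fin n × Fin n)} {k : ℕ}
    {l : List (Fin n)} {p : Fin n → Fin n} {s s' : State} (h : GrowInv T L k l p s)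
    {x y : Fin n} (hx : x ∈ l) (hy : y ∉ l) (hxy : T.graph.Adj y x)
    (hreg : ∀ r, r = 0 ∨ r = 2 ∨ r = 9 ∨ r = 10 ∨ r = 13 → s'.reg r = s.reg r)
    (hreg3 : s'.reg 3 = s.reg 3 + 1) (hreg4 : s'.reg 4 = 0)
    (harr : ∀ a, a ≠ 3 → a ≠ 4 → a ≠ 5 → s'.arr a = s.arr a)
    (harr3 : s'.arr 3 = Function.update (s.arr 3) y 1)
    (harr4 : s'.arr 4 = Function.update (s.arr 4) (s.reg 3) y)
    (harr5 : s'.arr 5 = Function.update (s.arr 5) y x) :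
    GrowInv T L k (y :: l) (Function.update p y x) s' where
  reg_n := (hreg 0 (by simp)).trans h.reg_n
  reg_k := (hreg 2 (by simp)).trans h.reg_k
  reg_len := by rw [hreg3, h.reg_len, List.length_cons]
  reg_edge := by rw [hreg4]; exact Nat.zero_le _
  reg_one := (hreg 9 (by simp)).trans h.reg_one
  reg_zero := (hreg 10 (by simp)).trans h.reg_zero
  reg_count := (hreg 13 (by simp)).trans h.reg_count
  fst i hi := by rw [harr 1 (by simp) (by simp) (by simp)]; exact h.fst i hi
  snd i hi := by rw [harr 2 (by simp) (by simp) (by simp)]; exact h.snd i hi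
  visited v := by
    rw [harr3, Function.update_apply, h.visited v]
    by_cases hv : v = y
    · simp [hv]
    · simp [hv, Fin.val_inj]
  stored := by
    rw [harr4, h.reg_len]
    exact ⟨Function.update_self .., h.stored.update le_rfl⟩
  par v := by
    rw [harr5, Function.update_apply, Function.update_apply, h.par v]
    by_cases hv : v = y
    · simp [hv]
    · simp [hv, Fin.val_inj]
  arr_six i := by rw [harr 6 (by simp) (by simp) (by simp)]; exact h.arr_six i
  arr_seven i := by rw [harr 7 (by simp) (by simp) (by simp)]; exact h.arr_seven i
  ne_nil := List.cons_ne_nil _ _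
  grown := h.grown.cons_update hx hy hxy
  closed i _ hi := by rw [hreg4] at hi; exact absurd hi (Nat.not_lt_zero _)

theorem _root_.IsEdgeList.adj_getElem {n : ℕ} {G : SimpleGraph (Fin n)}
    {L : List (Fin n × Fin n)} (hL : IsEdgeList G L) {i : ℕ} (hi : i < L.length) :
    G.Adj L[i].1 L[i].2 :=
  (hL.2 _ _).2 (List.mem_map.2 ⟨L[i], List.getElem_mem hi, rfl⟩)

theorem _root_.IsEdgeList.length_succ {n : ℕ} {G : SimpleGraph (Fin n)} (hG : G.IsTree)
    {L : List (Fin n × Fin n)} (hL : IsEdgeList G L) : L.length + 1 = n := by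
  classical
  have h := hG.card_edgeFinset
  rw [Fintype.card_fin] at h
  have h' : G.edgeFinset = (L.map fun p => s(p.1, p.2)).toFinset := by
    ext e
    induction e using Sym2.ind with
    | _ u v => rw [List.mem_toFinset, ← hL.2 u v, SimpleGraph.mem_edgeFinset]; rfl
  rw [h', List.toFinset_card_of_nodup hL.1, List.length_map] at h
  exact h

theorem _root_.List.Nodup.mem_of_length {n : ℕ} {l : List (Fin n)} (h : l.Nodup)
    (hl : n ≤ l.length) (v : Fin n) : v ∈ l := by
  have : l.toFinset = Finset.univ := by
    rw [← Finset.card_eq_iff_eq_univ, List.toFinset_card_of_nodup h, Fintype.card_fin]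
    have := h.length_le_card
    rw [Fintype.card_fin] at this
    omega
  rw [← List.mem_toFinset, this]
  exact Finset.mem_univ v

theorem GrowInv.reg_edge_lt {n : ℕ} {T : BipGraph (Fin n)} (hT : T.graph.IsTree)
    {L : List (Fin n × Fin n)} (hL : IsEdgeList T.graph L) {k : ℕ} {l : List (Fin n)}
    {p : Fin n → Fin n} {s : State} (h : GrowInv T L k l p s) (hlt : s.reg 3 < s.reg 0) :
    s.reg 4 < L.length := by
  by_contra hge
  have hcl : ∀ u v, T.graph.Adj u v → (u ∈ l ↔ v ∈ l) := by
    intro u v huv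
    obtain ⟨q, hq, hquv⟩ := List.mem_map.1 ((hL.2 u v).1 huv)
    obtain ⟨i, hi, rfl⟩ := List.getElem_of_mem hq
    have := h.closed i hi (by omega)
    rcases Sym2.eq_iff.1 hquv with ⟨rfl, rfl⟩ | ⟨rfl, rfl⟩
    · exact this
    · exact this.symm
  obtain ⟨r, hr⟩ := List.exists_mem_of_ne_nil _ h.ne_nil
  have hall := Grown.mem_of_closed hT.connected hr hcl
  have : n ≤ l.length := by
    rw [← List.toFinset_card_of_nodup h.grown.nodup,
      Finset.eq_univ_of_forall fun v => List.mem_toFinset.2 (hall v), Finset.card_univ,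
      Fintype.card_fin]
  rw [h.reg_len, h.reg_n] at hlt
  omega

/-- The variant of the first loop. -/
def growVariant (m : ℕ) (s : State) : ℕ := (s.reg 0 - s.reg 3) * (m + 1) + (m - s.reg 4)


theorem growVariant_lt {m : ℕ} {s s' : State} (hlt : s.reg 3 < s.reg 0)
    (h0 : s'.reg 0 = s.reg 0) (h3 : s'.reg 3 = s.reg 3 + 1) :
    growVariant m s' < growVariant m s := by
  obtain ⟨d, hd⟩ := Nat.exists_eq_add_of_lt hlt
  have h1 : s.reg 0 - s.reg 3 = d + 1 := by omega
  have h2 : s.reg 0 - (s.reg 3 + 1) = d := by omega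
  rw [growVariant, growVariant, h0, h3, h1, h2, Nat.add_mul]
  omega

theorem eval_growBody_of_eq {s : State}
    (h : s.arr 3 (s.arr 1 (s.reg 4)) = s.arr 3 (s.arr 2 (s.reg 4))) :
    (growBody.eval s).arr = s.arr ∧ (growBody.eval s).reg 4 = s.reg 4 + 1 ∧
      ∀ r, r = 0 ∨ r = 2 ∨ r = 3 ∨ r = 9 ∨ r = 10 ∨ r = 13 →
        (growBody.eval s).reg r = s.reg r := by
  refine ⟨?_, ?_, ?_⟩
  · simp [growBody, Prog.eval, Instr.apply, State.setReg, Test.Holds, h]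
  · simp [growBody, Prog.eval, Instr.apply, State.setReg, Test.Holds, h]
  · rintro r (rfl | rfl | rfl | rfl | rfl | rfl) <;>
    simp [growBody, Prog.eval, Instr.apply, State.setReg, Test.Holds, h]

theorem eval_growBody_of_ne {s : State} {x y : ℕ} (h1 : s.reg 9 = 1)
    (hxy : s.arr 1 (s.reg 4) = x ∧ s.arr 2 (s.reg 4) = y ∨
      s.arr 1 (s.reg 4) = y ∧ s.arr 2 (s.reg 4) = x)
    (hx : s.arr 3 x = 1) (hy : s.arr 3 y = 0) :
    (∀ r, r = 0 ∨ r = 2 ∨ r = 9 ∨ r = 10 ∨ r = 13 → (growBody.eval s).reg r = s.reg r) ∧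
      (growBody.eval s).reg 3 = s.reg 3 + 1 ∧ (growBody.eval s).reg 4 = 0 ∧
      (∀ a, a ≠ 3 → a ≠ 4 → a ≠ 5 → (growBody.eval s).arr a = s.arr a) ∧
      (growBody.eval s).arr 3 = Function.update (s.arr 3) y 1 ∧
      (growBody.eval s).arr 4 = Function.update (s.arr 4) (s.reg 3) y ∧
      (growBody.eval s).arr 5 = Function.update (s.arr 5) y x := by
  rcases hxy with ⟨e1, e2⟩ | ⟨e1, e2⟩ <;>
  refine ⟨?_, ?_, ?_, ?_, ?_, ?_, ?_⟩
  case inl.refine_1 | inr.refine_1 =>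
    rintro r (rfl | rfl | rfl | rfl | rfl) <;>
    simp [growBody, Prog.eval, Instr.apply, State.setReg, State.setArr, Test.Holds, h1, hx, hy,
      e1, e2]
  case inl.refine_4 | inr.refine_4 =>
    intro a h3 h4 h5
    simp [growBody, Prog.eval, Instr.apply, State.setReg, State.setArr, Test.Holds, h1, hx, hy,
      e1, e2, h3, h4, h5]
  all_goals
    simp [growBody, Prog.eval, Instr.apply, State.setReg, State.setArr, Test.Holds, h1, hx, hy,
      e1, e2]

theorem GrowInv.scan {n : ℕ} {T : BipGraph (Fin n)} {L : List (Fin n × Fin n)} {k : ℕ}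
    {l : List (Fin n)} {p : Fin n → Fin n} {s s' : State} (h : GrowInv T L k l p s)
    (he : s.reg 4 < L.length) (hl : L[s.reg 4].1 ∈ l ↔ L[s.reg 4].2 ∈ l) (harr : s'.arr = s.arr)
    (hreg4 : s'.reg 4 = s.reg 4 + 1)
    (hreg : ∀ r, r = 0 ∨ r = 2 ∨ r = 3 ∨ r = 9 ∨ r = 10 ∨ r = 13 → s'.reg r = s.reg r) :
    GrowInv T L k l p s' where
  reg_n := (hreg 0 (by simp)).trans h.reg_n
  reg_k := (hreg 2 (by simp)).trans h.reg_k
  reg_len := (hreg 3 (by simp)).trans h.reg_len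
  reg_edge := by omega
  reg_one := (hreg 9 (by simp)).trans h.reg_one
  reg_zero := (hreg 10 (by simp)).trans h.reg_zero
  reg_count := (hreg 13 (by simp)).trans h.reg_count
  fst := by rw [harr]; exact h.fst
  snd := by rw [harr]; exact h.snd
  visited := by rw [harr]; exact h.visited
  stored := by rw [harr]; exact h.stored
  par := by rw [harr]; exact h.par
  arr_six := by rw [harr]; exact h.arr_six
  arr_seven := by rw [harr]; exact h.arr_seven
  ne_nil := h.ne_nil
  grown := h.grown
  closed i hi hlt := by
    rw [hreg4] at hlt
    rcases Nat.lt_succ_iff_lt_or_eq.1 hlt with hlt | rfl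
    · exact h.closed i hi hlt
    · exact hl

theorem GrowInv.step {n : ℕ} {T : BipGraph (Fin n)} (hT : T.graph.IsTree)
    {L : List (Fin n × Fin n)} (hL : IsEdgeList T.graph L) {k : ℕ} {s : State}
    (h : ∃ l p, GrowInv T L k l p s) (hlt : (Test.lt 3 0).Holds s) :
    (∃ l p, GrowInv T L k l p (growBody.eval s)) ∧
      growVariant L.length (growBody.eval s) < growVariant L.length s := by
  obtain ⟨l, p, h⟩ := h
  replace hlt : s.reg 3 < s.reg 0 := hlt
  have he := h.reg_edge_lt hT hL hlt
  have hx := h.fst _ he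
  have hy := h.snd _ he
  have hadj := hL.adj_getElem he
  by_cases hl : L[s.reg 4].1 ∈ l ↔ L[s.reg 4].2 ∈ l
  · obtain ⟨harr, h4, hr⟩ := eval_growBody_of_eq (s := s) (by
      rw [hx, hy, h.visited, h.visited]; simp only [hl])
    refine ⟨⟨l, p, h.scan he hl harr h4 hr⟩, ?_⟩
    rw [growVariant, growVariant, hr 0 (by simp), hr 3 (by simp), h4]
    omega
  · have key : ∀ x y : Fin n, x ∈ l → y ∉ l → T.graph.Adj y x →
        (s.arr 1 (s.reg 4) = x ∧ s.arr 2 (s.reg 4) = y ∨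
          s.arr 1 (s.reg 4) = y ∧ s.arr 2 (s.reg 4) = x) →
        (∃ l p, GrowInv T L k l p (growBody.eval s)) ∧
          growVariant L.length (growBody.eval s) < growVariant L.length s := by
      intro x y hxl hyl hyx hxy
      obtain ⟨hr, h3, h4, ha, ha3, ha4, ha5⟩ := eval_growBody_of_ne h.reg_one hxy
        (by rw [h.visited, if_pos hxl]) (by rw [h.visited, if_neg hyl])
      exact ⟨⟨_, _, h.attach hxl hyl hyx hr h3 h4 ha ha3 ha4 ha5⟩,
        growVariant_lt hlt (hr 0 (by simp)) h3⟩
    by_cases hxl : L[s.reg 4].1 ∈ l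
    · exact key _ _ hxl (fun hyl => hl (iff_of_true hxl hyl)) hadj.symm (Or.inl ⟨hx, hy⟩)
    · exact key _ _ (by_contra fun hyl => hl (iff_of_false hxl hyl)) hxl hadj (Or.inr ⟨hx, hy⟩)

/-- The invariant of the second loop, which has still to visit the vertices in `l`. -/
structure GreedyInv {n : ℕ} (T : BipGraph (Fin n)) (k : ℕ) (p : Fin n → Fin n)
    (l : List (Fin n)) (D P : Finset (Fin n)) (s : State) : Prop where
  reg_k : s.reg 2 = k
  reg_len : s.reg 3 = l.length
  reg_one : s.reg 9 = 1
  reg_zero : s.reg 10 = 0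
  reg_count : s.reg 13 = P.card
  stored : Stored (s.arr 4) l
  par : ∀ v : Fin n, s.arr 5 v = p v
  covered : ∀ v : Fin n, (s.arr 6 v = 0 ↔ ¬ (v ∈ D ∨ ∃ c ∈ D, p c = v))
  selected : ∀ v : Fin n, (s.arr 7 v = 0 ↔ v ∉ D)
  grown : Grown T.graph p l
  greedy : Greedy T p l D P

theorem eval_greedyBody_of_skip {s : State}
    (h : s.arr 6 (s.arr 4 (s.reg 3 - 1)) ≠ s.reg 10 ∨
      s.arr 7 (s.arr 5 (s.arr 4 (s.reg 3 - 1))) ≠ s.reg 10) :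
    (greedyBody.eval s).arr = s.arr ∧ (greedyBody.eval s).reg 3 = s.reg 3 - 1 ∧
      ∀ r, r = 2 ∨ r = 9 ∨ r = 10 ∨ r = 13 → (greedyBody.eval s).reg r = s.reg r := by
  by_cases h6 : s.arr 6 (s.arr 4 (s.reg 3 - 1)) = s.reg 10
  · have h7 := h.resolve_left (not_not_intro h6)
    refine ⟨?_, ?_, ?_⟩
    · simp [greedyBody, Prog.eval, Instr.apply, State.setReg, Test.Holds, h6, h7]
    · simp [greedyBody, Prog.eval, Instr.apply, State.setReg, Test.Holds, h6, h7]
    · rintro r (rfl | rfl | rfl | rfl) <;>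
      simp [greedyBody, Prog.eval, Instr.apply, State.setReg, Test.Holds, h6, h7]
  · refine ⟨?_, ?_, ?_⟩
    · simp [greedyBody, Prog.eval, Instr.apply, State.setReg, Test.Holds, h6]
    · simp [greedyBody, Prog.eval, Instr.apply, State.setReg, Test.Holds, h6]
    · rintro r (rfl | rfl | rfl | rfl) <;>
      simp [greedyBody, Prog.eval, Instr.apply, State.setReg, Test.Holds, h6]

theorem eval_greedyBody_of_take {s : State} {v u w : ℕ} (hv : s.arr 4 (s.reg 3 - 1) = v)
    (hu : s.arr 5 v = u) (hw : s.arr 5 u = w) (h1 : s.reg 9 = 1)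
    (h6 : s.arr 6 v = s.reg 10) (h7 : s.arr 7 u = s.reg 10) :
    (greedyBody.eval s).arr 4 = s.arr 4 ∧ (greedyBody.eval s).arr 5 = s.arr 5 ∧
      (greedyBody.eval s).arr 6 = Function.update (Function.update (s.arr 6) u 1) w 1 ∧
      (greedyBody.eval s).arr 7 = Function.update (s.arr 7) u 1 ∧
      (greedyBody.eval s).reg 3 = s.reg 3 - 1 ∧ (greedyBody.eval s).reg 13 = s.reg 13 + 1 ∧
      ∀ r, r = 2 ∨ r = 9 ∨ r = 10 → (greedyBody.eval s).reg r = s.reg r := by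
  refine ⟨?_, ?_, ?_, ?_, ?_, ?_, ?_⟩
  case refine_7 =>
    rintro r (rfl | rfl | rfl) <;>
    simp [greedyBody, Prog.eval, Instr.apply, State.setReg, State.setArr, Test.Holds, hv, hu,
      h6, h7]
  all_goals
    simp [greedyBody, Prog.eval, Instr.apply, State.setReg, State.setArr, Test.Holds, hv, hu, hw,
      h1, h6, h7]

theorem GreedyInv.step {n : ℕ} {T : BipGraph (Fin n)} {k : ℕ} {p : Fin n → Fin n}
    (hp : T.IsParent p) {s : State} (h : ∃ l D P, GreedyInv T k p l D P s)
    (hlt : (Test.lt 10 3).Holds s) :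
    (∃ l D P, GreedyInv T k p l D P (greedyBody.eval s)) ∧
      (greedyBody.eval s).reg 3 < s.reg 3 := by
  obtain ⟨l, D, P, h⟩ := h
  replace hlt : s.reg 10 < s.reg 3 := hlt
  rw [h.reg_zero] at hlt
  have hlen := h.reg_len
  cases l with
  | nil => rw [h.reg_len] at hlt; exact absurd hlt (Nat.lt_irrefl _)
  | cons v l =>
    rw [List.length_cons] at hlen
    have hv : s.arr 4 (s.reg 3 - 1) = v := by
      rw [hlen, Nat.add_sub_cancel]; exact h.stored.1
    have hcov := h.covered v
    have hsel := h.selected (p v)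
    by_cases htake : s.arr 6 v = 0 ∧ s.arr 7 (p v) = 0
    · obtain ⟨h6, h7⟩ := htake
      obtain ⟨a4, a5, a6, a7, r3, r13, hr⟩ := eval_greedyBody_of_take hv (h.par v) (h.par (p v))
        h.reg_one (h6.trans h.reg_zero.symm) (h7.trans h.reg_zero.symm)
      have hg := h.greedy.take hp h.grown (hsel.1 h7) (hcov.1 h6)
      refine ⟨⟨l, insert (p v) D, insert v P, ?_⟩, by omega⟩
      refine
        { reg_k := (hr 2 (by simp)).trans h.reg_k
          reg_len := by omega
          reg_one := (hr 9 (by simp)).trans h.reg_one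
          reg_zero := (hr 10 (by simp)).trans h.reg_zero
          reg_count := ?_
          stored := by rw [a4]; exact h.stored.2
          par := by rw [a5]; exact h.par
          covered := fun u => ?_
          selected := fun u => ?_
          grown := h.grown.2.2.2
          greedy := hg }
      · rw [r13, h.reg_count, ← hg.card, Finset.card_insert_of_notMem (hsel.1 h7), h.greedy.card]
      · have hu := h.covered u
        rw [a6, Function.update_apply, Function.update_apply]
        simp only [Fin.val_inj, Finset.mem_insert, exists_eq_or_imp]
        by_cases e1 : u = p (p v)
        · simp [e1]
        · by_cases e2 : u = p v
          · simp [e2]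
          · simp only [if_neg e1, e2, if_false, hu, Ne.symm e1, false_or]
      · have hu := h.selected u
        rw [a7, Function.update_apply]
        by_cases e : u = p v
        · simp [e]
        · simp [Fin.val_inj, e, hu]
    · obtain ⟨harr, r3, hr⟩ := eval_greedyBody_of_skip (s := s) (by
        rw [hv, h.par v, h.reg_zero]; tauto)
      refine ⟨⟨l, D, P, ?_⟩, by omega⟩
      exact
        { reg_k := (hr 2 (by simp)).trans h.reg_k
          reg_len := by omega
          reg_one := (hr 9 (by simp)).trans h.reg_one
          reg_zero := (hr 10 (by simp)).trans h.reg_zero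
          reg_count := (hr 13 (by simp)).trans h.reg_count
          stored := by rw [harr]; exact h.stored.2
          par := by rw [harr]; exact h.par
          covered := by rw [harr]; exact h.covered
          selected := by rw [harr]; exact h.selected
          grown := h.grown.2.2.2
          greedy := h.greedy.skip (by tauto) }

/-- Computes the size of a minimum dominating set in register `13`. -/
def countProg : Prog :=
  .seq growInit <| .seq (.loop (.lt 3 0) growBody) <| .loop (.lt 10 3) greedyBody

theorem exec_countProg {n : ℕ} {T : BipGraph (Fin n)} (hT : T.graph.IsTree)
    {L : List (Fin n × Fin n)} (hL : IsEdgeList T.graph L) (k : ℕ) :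
    ∃ t s, Exec countProg (inputState T L k) t s ∧
      t ≤ (growInit.cost + growBody.cost + greedyBody.cost + 4) * n ^ 2 ∧ s.reg 2 = k ∧
      ∀ (S : Set Side) (j : ℕ), (∃ m ≤ j, T.CanBecomeBicluster S m) ↔ s.reg 13 - 1 ≤ j := by
  have hm := hL.length_succ hT
  have hn : 0 < n := by omega
  have hi : growInit.LoopFree := by simp [growInit, Prog.LoopFree]
  have hg : growBody.LoopFree := by simp [growBody, Prog.LoopFree]
  have hd : greedyBody.LoopFree := by simp [greedyBody, Prog.LoopFree]
  obtain ⟨t₀, ht₀, e₀⟩ := hi.exec (inputState T L k)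
  have inv := GrowInv.init hn T L k
  obtain ⟨t₁, s₁, e₁, ht₁, ⟨l, p, h₁⟩, hb₁⟩ := Exec.exists_loop (b := .lt 3 0) hg
    (fun s => ∃ l p, GrowInv T L k l p s) (growVariant L.length)
    (fun s h hlt => GrowInv.step hT hL h hlt) _ ⟨_, _, inv⟩
  replace hb₁ : ¬ s₁.reg 3 < s₁.reg 0 := hb₁
  rw [h₁.reg_len, h₁.reg_n, not_lt] at hb₁
  have hl := h₁.grown.nodup.mem_of_length hb₁
  have hll : l.length ≤ n := by
    have := h₁.grown.nodup.length_le_card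
    rwa [Fintype.card_fin] at this
  have hp := h₁.grown.isParent hT hl
  obtain ⟨t₂, s₂, e₂, ht₂, ⟨l', D, P, h₂⟩, hb₂⟩ := Exec.exists_loop (b := .lt 10 3) hd
    (fun s => ∃ l D P, GreedyInv T k p l D P s) (fun s => s.reg 3)
    (fun s h hlt => GreedyInv.step hp h hlt) s₁ ⟨l, ∅, ∅,
      { reg_k := h₁.reg_k
        reg_len := h₁.reg_len
        reg_one := h₁.reg_one
        reg_zero := h₁.reg_zero
        reg_count := h₁.reg_count
        stored := h₁.stored
        par := h₁.par
        covered := by simp [h₁.arr_six]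
        selected := by simp [h₁.arr_seven]
        grown := h₁.grown
        greedy := ⟨fun v hv => absurd (hl v) hv, by simp, by simp, by simp [BipGraph.IsPacking],
          rfl⟩ }⟩
  replace hb₂ : ¬ s₂.reg 10 < s₂.reg 3 := hb₂
  have hl' : l' = [] := by
    rw [h₂.reg_zero, h₂.reg_len] at hb₂
    exact List.eq_nil_of_length_eq_zero (by omega)
  subst hl'
  refine ⟨_, s₂, .seq e₀ (.seq e₁ e₂), ?_, h₂.reg_k, fun S j => ?_⟩
  · have hμ : growVariant L.length (growInit.eval (inputState T L k)) ≤ n ^ 2 := by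
      rw [growVariant, inv.reg_n, inv.reg_len, hm, List.length_singleton, Nat.sub_mul, ← sq]
      have : n ≤ n ^ 2 := Nat.le_self_pow two_ne_zero n
      omega
    have hnn : n ≤ n ^ 2 := Nat.le_self_pow two_ne_zero n
    have h3 : s₁.reg 3 ≤ n ^ 2 := by rw [h₁.reg_len]; exact hll.trans hnn
    have b1 := Nat.mul_le_mul_left (growBody.cost + 1) hμ
    have b2 := Nat.mul_le_mul_left (greedyBody.cost + 1) h3
    have b0 := Nat.mul_le_mul_left growInit.cost (hn.trans_le hnn)
    simp only [Nat.add_mul] at b1 b2 ht₁ ht₂ ⊢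
    omega
  · rw [h₂.reg_count]
    exact BipGraph.exists_canBecomeBicluster_iff hT hp
      (h₂.greedy.isDominating fun v => h₁.grown.eq_or_adj v (hl v)) h₂.greedy.packing
      h₂.greedy.card S j

/-- Leaves in register `0` the number computed by `countProg`, minus `1`. -/
def minProg : Prog :=
  .seq countProg <| .seq (.instr (.pred 13)) (.instr (.move 0 13))

/-- Compares `k` with the number computed by `countProg`, minus `1`. -/
def decideProg : Prog :=
  .seq countProg <| .seq (.instr (.pred 13)) <|
    .ite (.lt 2 13) (.instr (.const 0 0)) (.instr (.const 0 1))

theorem exec_minProg {n : ℕ} {T : BipGraph (Fin n)} (hT : T.graph.IsTree)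
    {L : List (Fin n × Fin n)} (hL : IsEdgeList T.graph L) (S : Set Side) :
    ∃ t s, Exec minProg (inputState T L 0) t s ∧
      t ≤ (growInit.cost + growBody.cost + greedyBody.cost + 7) * n ^ 2 ∧
      IsLeast {k | ∃ m ≤ k, T.CanBecomeBicluster S m} (s.reg 0) := by
  obtain ⟨t, s, he, ht, -, hs⟩ := exec_countProg hT hL 0
  refine ⟨_, _, .seq he (.seq (.instr _ _) (.instr _ _)), ?_, ?_⟩
  · have hm := hL.length_succ hT
    have hn : 0 < n ^ 2 := Nat.pow_pos (by omega)
    simp only [Nat.add_mul] at ht ⊢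
    omega
  · have h0 : ((Instr.move 0 13).apply ((Instr.pred 13).apply s)).reg 0 = s.reg 13 - 1 := by
      simp [Instr.apply, State.setReg]
    rw [h0]
    exact ⟨(hs S _).2 le_rfl, fun k hk => (hs S k).1 hk⟩

theorem exec_decideProg {n : ℕ} {T : BipGraph (Fin n)} (hT : T.graph.IsTree)
    {L : List (Fin n × Fin n)} (hL : IsEdgeList T.graph L) (k : ℕ) (S : Set Side) :
    ∃ t s, Exec decideProg (inputState T L k) t s ∧
      t ≤ (growInit.cost + growBody.cost + greedyBody.cost + 7) * n ^ 2 ∧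
      ((∃ m ≤ k, T.CanBecomeBicluster S m) → s.reg 0 = 1) ∧
      (¬ (∃ m ≤ k, T.CanBecomeBicluster S m) → s.reg 0 = 0) := by
  obtain ⟨t, s, he, ht, hk, hs⟩ := exec_countProg hT hL k
  have hm := hL.length_succ hT
  have hn : 0 < n ^ 2 := Nat.pow_pos (by omega)
  rw [hs S k]
  have htest : (Test.lt 2 13).Holds ((Instr.pred 13).apply s) ↔ k < s.reg 13 - 1 := by
    simp [Test.Holds, Instr.apply, State.setReg, hk]
  by_cases h : s.reg 13 - 1 ≤ k
  · refine ⟨_, _, .seq he (.seq (.instr _ _) (.ite_false (fun h' => ?_) (.instr _ _))), ?_, ?_, ?_⟩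
    · have := htest.1 h'; omega
    · simp only [Nat.add_mul] at ht ⊢
      omega
    · intro _; simp [Instr.apply, State.setReg]
    · exact fun h' => absurd h h'
  · refine ⟨_, _, .seq he (.seq (.instr _ _) (.ite_true (htest.2 (by omega)) (.instr _ _))),
      ?_, ?_, ?_⟩
    · simp only [Nat.add_mul] at ht ⊢
      omega
    · exact fun h' => absurd h' h
    · intro _; simp [Instr.apply, State.setReg]

end RAM

theorem mainTheorem5 :
    (∃ (P : RAM.Prog) (C : ℕ), DecidesOnTrees P BCEVS (fun n => C * n ^ 2)) ∧
    (∃ (P : RAM.Prog) (C : ℕ), DecidesOnTrees P BCEOVS (fun n => C * n ^ 2)) ∧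
    (∃ (P : RAM.Prog) (C : ℕ), ComputesMinOnTrees P BCEVS (fun n => C * n ^ 2)) ∧
    (∃ (P : RAM.Prog) (C : ℕ), ComputesMinOnTrees P BCEOVS (fun n => C * n ^ 2)) :=
  ⟨⟨_, _, fun _ _ _ k hT hL => RAM.exec_decideProg hT hL k Set.univ⟩,
    ⟨_, _, fun _ _ _ k hT hL => RAM.exec_decideProg hT hL k {Side.B}⟩,
    ⟨_, _, fun _ _ _ hT hL => RAM.exec_minProg hT hL Set.univ⟩,
    ⟨_, _, fun _ _ _ hT hL => RAM.exec_minProg hT hL {Side.B}⟩⟩
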